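/- Theorem 4.4. Let $d\ge 0$ be an integer and $s>0$. Write $(u,\phi)$ for the action of $u\in\mathscr S'(\mathbf R^n)$ on $\phi\in\mathscr S(\mathbf R^n)$ that is conjugate linear in $\phi$ and consistent with the $L^2$ inner product. For a window $\varphi\in\mathscr S(\mathbf R^n)\setminus\{0\}$ and $u\in\mathscr S'(\mathbf R^n)$ let $$V_\varphi u(x,\xi)=(2\pi)^{-n/2}\,(u,\;e^{i\langle\cdot,\xi\rangle}\varphi(\cdot-x)),\qquad x,\xi\in\mathbf R^n,$$ be the short-time Fourier transform. The $s$-Gabor wave front set $\mathrm{WF}^s_{\rm g}(u)\subseteq T^*\mathbf R^n\setminus 0$ is the set of all $z_0\in T^*\mathbf R^n\setminus 0$ for which there is no open set $U\subseteq T^*\mathbf R^n$ such that $z_0\in U$ and $$\sup_{(x,\xi)\in U,\ \lambda>0}\lambda^N|V_\varphi u(\lambda x,\lambda^s\xi)|<\infty\quad\text{for all } N\ge 0.$$ This set does not depend on the window; below, each wave front set may be computed with its own arbitrary nonzero window. Let $K\in\mathscr S'(\mathbf R^{2d})$, and let $\mathscr K:\mathscr S(\mathbf R^d)\to\mathscr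 S'(\mathbf R^d)$ be the continuous linear operator defined by $$(\mathscr Kf,g)=(K,\,g\otimes\overline f),\qquad f,g\in\mathscr S(\mathbf R^d).$$ Suppose that $\mathrm{WF}^s_{\rm g}(K)\subseteq T^*\mathbf R^{2d}\setminus 0$ contains no point of the form $(x,0,\xi,0)$ and no point of the form $(0,y,0,-\eta)$ with $x,y,\xi,\eta\in\mathbf R^d$. Then $\mathscr K$ extends uniquely to a sequentially continuous linear operator $\mathscr K:\mathscr S'(\mathbf R^d)\to\mathscr S'(\mathbf R^d)$, and for every $u\in\mathscr S'(\mathbf R^d)$ $$\mathrm{WF}^s_{\rm g}(\mathscr Ku)\subseteq \mathrm{WF}^s_{\rm g}(K)'\circ\mathrm{WF}^s_{\rm g}(u):=\{(x,\xi)\in\mathbf R^{2d}:\ \exists\,(y,\eta)\in\mathrm{WF}^s_{\rm g}(u),\ (x,y,\xi,-\eta)\in\mathrm{WF}^s_{\rm g}(K)\}.$$ -/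

import Mathlib

open scoped SchwartzMap ContDiff

namespace GaborWF

noncomputable section

/-- The space `ℝ^d` with its Euclidean norm. -/
abbrev Rd (d : ℕ) : Type := EuclideanSpace ℝ (Fin d)

/-- The space `ℝ^{2d} = ℝ^d × ℝ^d`, with the Euclidean norm of the product. -/
abbrev R2d (d : ℕ) : Type := WithLp 2 (Rd d × Rd d)

section TimeFrequency

variable {V : Type*} [NormedAddCommGroup V] [InnerProductSpace ℝ V]

theorem hasTemperateGrowth_exp_mul_I :
    (fun t : ℝ ↦ Complex.exp ((t : ℂ) * Complex.I)).HasTemperateGrowth := by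
  refine ⟨(Complex.ofRealCLM.contDiff.mul contDiff_const).cexp, fun n ↦ ⟨0, 1, fun t ↦ ?_⟩⟩
  have key : iteratedDeriv n (fun t : ℝ ↦ Complex.exp ((t : ℂ) * Complex.I)) =
      fun t : ℝ ↦ Complex.I ^ n * Complex.exp ((t : ℂ) * Complex.I) := by
    induction n with
    | zero => simp
    | succ n ih =>
      rw [iteratedDeriv_succ, ih]
      funext t
      have h : HasDerivAt (fun t : ℝ ↦ Complex.exp ((t : ℂ) * Complex.I))
          (Complex.exp ((t : ℂ) * Complex.I) * (1 * Complex.I)) t :=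
        ((Complex.ofRealCLM.hasDerivAt (x := t)).mul_const Complex.I).cexp
      rw [(h.const_mul (Complex.I ^ n)).deriv]
      ring
  rw [norm_iteratedFDeriv_eq_norm_iteratedDeriv, key]
  simp [Complex.norm_exp_ofReal_mul_I]

/-- The character `y ↦ e^{i⟨y, ξ⟩}`. -/
def character (ξ : V) (y : V) : ℂ := Complex.exp (((inner ℝ y ξ : ℝ) : ℂ) * Complex.I)

theorem hasTemperateGrowth_character (ξ : V) : (character ξ).HasTemperateGrowth :=
  hasTemperateGrowth_exp_mul_I.comp (Function.hasTemperateGrowth_inner_left ξ)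

/-- Translation `T_x f (y) = f (y - x)`. -/
def translation (x : V) : 𝓢(V, ℂ) →L[ℂ] 𝓢(V, ℂ) := SchwartzMap.compSubConstCLM ℂ x

/-- Modulation `M_ξ f (y) = e^{i⟨y, ξ⟩} f (y)`. -/
def modulation (ξ : V) : 𝓢(V, ℂ) →L[ℂ] 𝓢(V, ℂ) := SchwartzMap.smulLeftCLM ℂ (character ξ)

theorem translation_apply (x : V) (f : 𝓢(V, ℂ)) (y : V) : translation x f y = f (y - x) := rfl

theorem modulation_apply (ξ : V) (f : 𝓢(V, ℂ)) (y : V) :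
    modulation ξ f y = Complex.exp (((inner ℝ y ξ : ℝ) : ℂ) * Complex.I) * f y := by
  simp [modulation, hasTemperateGrowth_character, character]

/-- The complex conjugate of a Schwartz function. -/
def conjugate (f : 𝓢(V, ℂ)) : 𝓢(V, ℂ) :=
  SchwartzMap.postcompCLM (𝕜 := ℝ) (Complex.conjCLE : ℂ →L[ℝ] ℂ) f

theorem conjugate_apply (f : 𝓢(V, ℂ)) (y : V) :
    conjugate f y = (starRingEnd ℂ) (f y) := rfl

/-- The sesquilinear action `(u, φ)` of a tempered distribution on a test function. It extends
the `L²` inner product that is conjugate linear in the second argument; Mathlib's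
action `u φ` is linear in `φ`. -/
def action (u : 𝓢'(V, ℂ)) (φ : 𝓢(V, ℂ)) : ℂ := u (conjugate φ)

/-- The short-time Fourier transform
`V_φ u (x, ξ) = (2π)^{-n/2} (u, M_ξ T_x φ)`, where `n = dim V`. -/
def stft (φ : 𝓢(V, ℂ)) (u : 𝓢'(V, ℂ)) (x ξ : V) : ℂ :=
  (((2 * Real.pi) ^ (-(Module.finrank ℝ V : ℝ) / 2) : ℝ) : ℂ) *
    action u (modulation ξ (translation x φ))

/-- The `s`-Gabor wave front set of `u`, computed with the window `φ`,
as a subset of `T^*V \ 0`. -/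
def wavefront (s : ℝ) (φ : 𝓢(V, ℂ)) (u : 𝓢'(V, ℂ)) : Set (V × V) :=
  {z₀ | z₀ ≠ 0 ∧ ¬ ∃ U : Set (V × V), IsOpen U ∧ z₀ ∈ U ∧
    ∀ N : ℕ, ∃ C : ℝ, ∀ z ∈ U, ∀ l : ℝ, 0 < l →
      l ^ N * ‖stft φ u (l • z.1) (l ^ s • z.2)‖ ≤ C}

end TimeFrequency

section Tensor

variable {E F : Type*} [NormedAddCommGroup E] [NormedSpace ℝ E]
  [NormedAddCommGroup F] [NormedSpace ℝ F]

theorem norm_iteratedFDeriv_comp_le {G : Type*} [NormedAddCommGroup G] [NormedSpace ℝ G]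
    (L : G →L[ℝ] E) (hL : ‖L‖ ≤ 1) (g : 𝓢(E, ℂ)) (i : ℕ) (z : G) :
    ‖iteratedFDeriv ℝ i (fun z ↦ g (L z)) z‖ ≤ ‖iteratedFDeriv ℝ i g (L z)‖ := by
  have h := L.iteratedFDeriv_comp_right (f := g) (n := ∞) (g.smooth ⊤) z (i := i)
    (by exact_mod_cast le_top)
  change ‖iteratedFDeriv ℝ i (g ∘ L) z‖ ≤ _
  rw [h]
  refine (ContinuousMultilinearMap.norm_compContinuousLinearMap_le _ _).trans ?_
  refine mul_le_of_le_one_right (norm_nonneg _) ?_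
  simpa using pow_le_one₀ (norm_nonneg _) hL

theorem tensor_bound (k n : ℕ) (g : 𝓢(E, ℂ)) (f : 𝓢(F, ℂ)) (z : WithLp 2 (E × F)) :
    ‖z‖ ^ k * ‖iteratedFDeriv ℝ n (fun z : WithLp 2 (E × F) ↦ g z.fst * f z.snd) z‖ ≤
      2 ^ n * ((2 ^ k * (Finset.Iic (k, n)).sup (schwartzSeminormFamily ℂ E ℂ) g) *
        (2 ^ k * (Finset.Iic (k, n)).sup (schwartzSeminormFamily ℂ F ℂ) f)) := by
  let L₁ : WithLp 2 (E × F) →L[ℝ] E := WithLp.fstL 2 ℝ E F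
  let L₂ : WithLp 2 (E × F) →L[ℝ] F := WithLp.sndL 2 ℝ E F
  have hL₁ : ‖L₁‖ ≤ 1 := L₁.opNorm_le_bound zero_le_one fun z ↦ by
    rw [one_mul]; exact WithLp.norm_fst_le (p := 2) E z
  have hL₂ : ‖L₂‖ ≤ 1 := L₂.opNorm_le_bound zero_le_one fun z ↦ by
    rw [one_mul]; exact WithLp.norm_snd_le (p := 2) E z
  set A := 2 ^ k * (Finset.Iic (k, n)).sup (schwartzSeminormFamily ℂ E ℂ) g
  set B := 2 ^ k * (Finset.Iic (k, n)).sup (schwartzSeminormFamily ℂ F ℂ) f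
  have hz : ‖z‖ ≤ (1 + ‖z.fst‖) * (1 + ‖z.snd‖) := by
    have h := WithLp.prod_norm_sq_eq_of_L2 z
    have h1 := norm_nonneg z.fst
    have h2 := norm_nonneg z.snd
    refine abs_le_of_sq_le_sq' ?_ (by positivity) |>.2
    rw [h]
    nlinarith [mul_nonneg h1 h2, mul_nonneg (mul_nonneg h1 h2) (mul_nonneg h1 h2),
      mul_nonneg (mul_nonneg h1 h2) h1, mul_nonneg (mul_nonneg h1 h2) h2]
  have hs₁ : ContDiff ℝ ∞ (fun z ↦ g (L₁ z)) := (g.smooth ⊤).comp L₁.contDiff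
  have hs₂ : ContDiff ℝ ∞ (fun z ↦ f (L₂ z)) := (f.smooth ⊤).comp L₂.contDiff
  have hmul := norm_iteratedFDeriv_mul_le hs₁ hs₂ z (n := n) (by exact_mod_cast le_top)
  have hterm : ∀ i ∈ Finset.range (n + 1),
      ‖z‖ ^ k * ((n.choose i : ℝ) * ‖iteratedFDeriv ℝ i (fun z ↦ g (L₁ z)) z‖ *
        ‖iteratedFDeriv ℝ (n - i) (fun z ↦ f (L₂ z)) z‖) ≤ (n.choose i : ℝ) * (A * B) := by
    intro i hi
    have hi' : i ≤ n := Nat.lt_succ_iff.mp (Finset.mem_range.mp hi)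
    have h1 : (1 + ‖z.fst‖) ^ k * ‖iteratedFDeriv ℝ i g z.fst‖ ≤ A :=
      SchwartzMap.one_add_le_sup_seminorm_apply (𝕜 := ℂ) (m := (k, n)) le_rfl hi' g z.fst
    have h2 : (1 + ‖z.snd‖) ^ k * ‖iteratedFDeriv ℝ (n - i) f z.snd‖ ≤ B :=
      SchwartzMap.one_add_le_sup_seminorm_apply (𝕜 := ℂ) (m := (k, n)) le_rfl
        (Nat.sub_le n i) f z.snd
    have e1 : ‖iteratedFDeriv ℝ i (fun z ↦ g (L₁ z)) z‖ ≤ ‖iteratedFDeriv ℝ i g z.fst‖ :=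
      norm_iteratedFDeriv_comp_le L₁ hL₁ g i z
    have e2 : ‖iteratedFDeriv ℝ (n - i) (fun z ↦ f (L₂ z)) z‖ ≤
        ‖iteratedFDeriv ℝ (n - i) f z.snd‖ :=
      norm_iteratedFDeriv_comp_le L₂ hL₂ f (n - i) z
    calc _ ≤ ((1 + ‖z.fst‖) * (1 + ‖z.snd‖)) ^ k *
            ((n.choose i : ℝ) * ‖iteratedFDeriv ℝ i g z.fst‖ *
              ‖iteratedFDeriv ℝ (n - i) f z.snd‖) := by gcongr
      _ = (n.choose i : ℝ) * (((1 + ‖z.fst‖) ^ k * ‖iteratedFDeriv ℝ i g z.fst‖) *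
            ((1 + ‖z.snd‖) ^ k * ‖iteratedFDeriv ℝ (n - i) f z.snd‖)) := by
          rw [mul_pow]; ring
      _ ≤ _ := by
          have : 0 ≤ A := le_trans (by positivity) h1
          gcongr
  calc _ ≤ ‖z‖ ^ k * _ := by
        exact mul_le_mul_of_nonneg_left hmul (by positivity)
    _ = ∑ i ∈ Finset.range (n + 1), _ := Finset.mul_sum _ _ _
    _ ≤ ∑ i ∈ Finset.range (n + 1), (n.choose i : ℝ) * (A * B) := Finset.sum_le_sum hterm
    _ = 2 ^ n * (A * B) := by
      rw [← Finset.sum_mul]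
      congr 1
      exact_mod_cast Nat.sum_range_choose n

theorem tensor_contDiff (g : 𝓢(E, ℂ)) (f : 𝓢(F, ℂ)) :
    ContDiff ℝ ∞ (fun z : WithLp 2 (E × F) ↦ g z.fst * f z.snd) :=
  ((g.smooth ⊤).comp (WithLp.fstL 2 ℝ E F).contDiff).mul
    ((f.smooth ⊤).comp (WithLp.sndL 2 ℝ E F).contDiff)

/-- The tensor product `(g ⊗ f)(x, y) = g x * f y`, as a continuous linear map of `g`. -/
def tensorLeft (f : 𝓢(F, ℂ)) : 𝓢(E, ℂ) →L[ℂ] 𝓢(WithLp 2 (E × F), ℂ) :=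
  SchwartzMap.mkCLM (fun g z ↦ g z.fst * f z.snd)
    (fun _ _ _ ↦ by simp [add_mul]) (fun _ _ _ ↦ by simp [mul_assoc])
    (fun g ↦ tensor_contDiff g f) fun ⟨k, n⟩ ↦
      ⟨Finset.Iic (k, n), 2 ^ n * (2 ^ k *
        (2 ^ k * (Finset.Iic (k, n)).sup (schwartzSeminormFamily ℂ F ℂ) f)),
        by positivity, fun g z ↦ (tensor_bound k n g f z).trans_eq (by ring)⟩

/-- The tensor product `(g ⊗ f)(x, y) = g x * f y`, as a continuous linear map of `f`. -/
def tensorRight (g : 𝓢(E, ℂ)) : 𝓢(F, ℂ) →L[ℂ] 𝓢(WithLp 2 (E × F), ℂ) :=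
  SchwartzMap.mkCLM (fun f z ↦ g z.fst * f z.snd)
    (fun _ _ _ ↦ by simp [mul_add]) (fun _ _ _ ↦ by simp [mul_left_comm])
    (fun f ↦ tensor_contDiff g f) fun ⟨k, n⟩ ↦
      ⟨Finset.Iic (k, n), 2 ^ n * ((2 ^ k *
        (Finset.Iic (k, n)).sup (schwartzSeminormFamily ℂ E ℂ) g) * 2 ^ k),
        by positivity, fun f z ↦ (tensor_bound k n g f z).trans_eq (by ring)⟩

/-- The tensor product `(g ⊗ f)(x, y) = g x * f y` of Schwartz functions. -/
def tensor (g : 𝓢(E, ℂ)) (f : 𝓢(F, ℂ)) : 𝓢(WithLp 2 (E × F), ℂ) := tensorLeft f g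

theorem tensor_apply (g : 𝓢(E, ℂ)) (f : 𝓢(F, ℂ)) (z : WithLp 2 (E × F)) :
    tensor g f z = g z.fst * f z.snd := rfl

end Tensor

section Kernel

variable {d : ℕ}

/-- The continuous linear operator `𝒦 : 𝓢(ℝ^d) → 𝓢'(ℝ^d)` with Schwartz kernel `K`; in terms
of the linear action of distributions it reads `(𝒦 f)(g) = K (g ⊗ f)`. -/
def kernelOp (K : 𝓢'(R2d d, ℂ)) : 𝓢(Rd d, ℂ) →L[ℂ] 𝓢'(Rd d, ℂ) where
  toFun f := PointwiseConvergenceCLM.precomp ℂ (tensorLeft f) K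
  map_add' f₁ f₂ := by
    ext g
    exact (congrArg K (map_add (tensorRight g) f₁ f₂)).trans (map_add K _ _)
  map_smul' c f := by
    ext g
    exact (congrArg K (map_smul (tensorRight g) c f)).trans (map_smul K _ _)
  cont := PointwiseConvergenceCLM.continuous_of_continuous_eval fun g ↦
    K.continuous.comp (tensorRight g).continuous

theorem kernelOp_apply (K : 𝓢'(R2d d, ℂ)) (f g : 𝓢(Rd d, ℂ)) :
    kernelOp K f g = K (tensor g f) := rfl

/-- In terms of the sesquilinear action, `(𝒦 f, g) = (K, g ⊗ conj f)`. -/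
theorem action_kernelOp (K : 𝓢'(R2d d, ℂ)) (f g : 𝓢(Rd d, ℂ)) :
    action (kernelOp K f) g = action K (tensor g (conjugate f)) := by
  change K (tensor (conjugate g) f) = K (conjugate (tensor g (conjugate f)))
  congr 1
  ext z
  simp [tensor_apply, conjugate_apply]

/-- `T` is a sequentially continuous linear operator on `𝓢'(ℝ^d)` that extends `𝒦`, where
`𝓢(ℝ^d)` is embedded in `𝓢'(ℝ^d)` by integration. -/
structure IsExtension (K : 𝓢'(R2d d, ℂ)) (T : 𝓢'(Rd d, ℂ) →ₗ[ℂ] 𝓢'(Rd d, ℂ)) : Prop where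
  seqContinuous : SeqContinuous T
  extends_kernelOp : ∀ f : 𝓢(Rd d, ℂ),
    T (SchwartzMap.toTemperedDistributionCLM (Rd d) ℂ MeasureTheory.volume f) = kernelOp K f

/-- The point `(x, y, ξ, η)` of `T^*ℝ^{2d}`, with base point `(x, y)` and covector `(ξ, η)`. -/
def phasePoint (x y ξ η : Rd d) : R2d d × R2d d := (WithLp.toLp 2 (x, y), WithLp.toLp 2 (ξ, η))

/-- The set of `(x, ξ)` such that `(x, 0, ξ, 0) ∈ A`. -/
def firstAxis (A : Set (R2d d × R2d d)) : Set (Rd d × Rd d) :=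
  {z | phasePoint z.1 0 z.2 0 ∈ A}

/-- The set of `(y, η)` such that `(0, y, 0, -η) ∈ A`. -/
def secondAxis (A : Set (R2d d × R2d d)) : Set (Rd d × Rd d) :=
  {z | phasePoint 0 z.1 0 (-z.2) ∈ A}

/-- The relation mapping
`A' ∘ B = {(x, ξ) | ∃ (y, η) ∈ B, (x, y, ξ, -η) ∈ A}`. -/
def twistedComp (A : Set (R2d d × R2d d)) (B : Set (Rd d × Rd d)) : Set (Rd d × Rd d) :=
  {z | ∃ w ∈ B, phasePoint z.1 w.1 z.2 (-w.2) ∈ A}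

end Kernel

end

end GaborWF

/-! Write `c` for `windowConst χ`, for a nonzero window `χ`. Everything rests on the inversion
formula `u f = c ∫ windowCoeff χ f z * u (conjugate (atom z χ))` (`apply_eq_integral_windowCoeff`),
which holds for every tempered distribution because superpositions of atoms with rapidly decaying
coefficients converge weakly in the Schwartz space (`exists_schwartz_integral`). Put `F z w = K
(conjugate (atom z χ) ⊗ conjugate (atom w χ))`, the transform of `K` for the tensor window.
Inverting in the second variable suggests `T u g = c ∫ K (g ⊗ conjugate (atom w χ)) * u (atom w χ)
dw`; with `g = conjugate (atom z χ)` the transform of `T u` at `z` is `c ∫ F z w * u (atom w χ) dw`.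
Since `u (atom w χ)` is the transform of `u` with window `conjugate χ` at `(w.1, -w.2)`, the sign in
the twisted composition appears. Convergence: the condition on `secondAxis` and compactness of the
unit sphere make `F` decay on the dilations of a neighbourhood of `{0} × sphere`. Dilating shows
that `F z w` decays rapidly in `w` up to a power of `1 + ‖z‖` (`exists_decay_snd`), a power that the
coefficients of `g` absorb. So `w ↦ K (g ⊗ conjugate (atom w χ))` decays rapidly, `T u g` is `c`
times `u` applied to a fixed Schwartz function, and continuity of `T` is immediate
(`exists_extension`). Uniqueness holds because truncated inversion integrals approximate any `u` by
Schwartz functions (`exists_seq_tendsto`). Inclusion: let `z₀ ≠ 0` lie outside the composition. For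
each `w`, either `F` decays near `(z₀, w)` or `u` decays near `(w.1, -w.2)`; the condition on
`firstAxis` puts `w = 0` in the first case. Compactness handles bounded `w`. For large `w`, dilating
to the unit sphere brings the first variable close to `0`, where the `secondAxis` decay applies
(`exists_decay_of_large_snd`). Integrating in `w` gives decay of the transform of `T u` near `z₀`.
Arbitrary windows are allowed because a change of window is dominated by convolution with a rapidly
decaying function, which preserves decay in anisotropic cones (`ConeDecay.of_le_convolution`). -/

open scoped FourierTransform
open MeasureTheory Filter Topology

namespace GaborWF

noncomputable section

/-! ### Seminorms on the Schwartz space. -/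

section SchwartzSeminorms

variable {E : Type*} [NormedAddCommGroup E] [NormedSpace ℝ E]

/-- A continuous seminorm on the Schwartz space is dominated by one of the standard norms. -/
theorem exists_le_sup_seminorm (p : Seminorm ℂ 𝓢(E, ℂ)) (hp : Continuous p) :
    ∃ (k n : ℕ) (C : NNReal), ∀ f, p f ≤
      C * (Finset.Iic (k, n)).sup (schwartzSeminormFamily ℂ E ℂ) f := by
  obtain ⟨s, C, -, h⟩ := Seminorm.bound_of_continuous (schwartz_withSeminorms ℂ E ℂ) p hp
  -- The componentwise maximum of the finite index set dominates every index in it.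
  refine ⟨(s.sup id).1, (s.sup id).2, C, fun f ↦ ?_⟩
  have h2 : s.sup (schwartzSeminormFamily ℂ E ℂ) ≤
      (Finset.Iic (s.sup id)).sup (schwartzSeminormFamily ℂ E ℂ) :=
    Finset.sup_mono fun i hi ↦ Finset.mem_Iic.2 (Finset.le_sup (f := id) hi)
  calc p f ≤ (C • s.sup (schwartzSeminormFamily ℂ E ℂ)) f := h f
    _ = C * s.sup (schwartzSeminormFamily ℂ E ℂ) f := rfl
    _ ≤ _ := mul_le_mul_of_nonneg_left (h2 f) C.2

theorem continuous_sup_seminorm (s : Finset (ℕ × ℕ)) :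
    Continuous (s.sup (schwartzSeminormFamily ℂ E ℂ) : Seminorm ℂ 𝓢(E, ℂ)) := by
  refine Seminorm.continuous_of_le (q := ∑ i ∈ s, schwartzSeminormFamily ℂ E ℂ i) ?_
    (Seminorm.finset_sup_le_sum _ _)
  have : (⇑(∑ i ∈ s, schwartzSeminormFamily ℂ E ℂ i) : 𝓢(E, ℂ) → ℝ) =
      fun f ↦ ∑ i ∈ s, schwartzSeminormFamily ℂ E ℂ i f := by
    ext f
    simp
  rw [this]
  exact continuous_finsetSum _ fun i _ ↦ (schwartz_withSeminorms ℂ E ℂ).continuous_seminorm i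

theorem exists_continuous_seminorm_bound {F : Type*} [SeminormedAddCommGroup F] [NormedSpace ℂ F]
    (u : 𝓢(E, ℂ) →L[ℂ] F) : ∃ p : Seminorm ℂ 𝓢(E, ℂ), Continuous p ∧ ∀ f, ‖u f‖ = p f :=
  ⟨(normSeminorm ℂ F).comp u.toLinearMap, continuous_norm.comp u.continuous, fun _ ↦ rfl⟩

end SchwartzSeminorms

/-! ### Translations of Schwartz functions. -/

section Translation

variable {V : Type*} [NormedAddCommGroup V] [InnerProductSpace ℝ V]

theorem norm_pow_mul_norm_iteratedFDeriv_sub_le (k n : ℕ) (f : 𝓢(V, ℂ)) (t x : V) :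
    ‖t‖ ^ k * ‖iteratedFDeriv ℝ n f (t - x)‖ ≤
      (1 + ‖x‖) ^ k * (2 ^ k * (Finset.Iic (k, n)).sup (schwartzSeminormFamily ℂ V ℂ) f) := by
  have h1 := SchwartzMap.one_add_le_sup_seminorm_apply (𝕜 := ℂ) (m := (k, n)) le_rfl le_rfl f
    (t - x)
  have h2 : ‖t‖ ≤ (1 + ‖x‖) * (1 + ‖t - x‖) := by
    have : ‖t‖ ≤ ‖t - x‖ + ‖x‖ := by simpa using norm_add_le (t - x) x
    nlinarith [norm_nonneg x, norm_nonneg (t - x), mul_nonneg (norm_nonneg x) (norm_nonneg (t - x))]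
  calc _ ≤ ((1 + ‖x‖) * (1 + ‖t - x‖)) ^ k * ‖iteratedFDeriv ℝ n f (t - x)‖ := by gcongr
    _ = (1 + ‖x‖) ^ k * ((1 + ‖t - x‖) ^ k * ‖iteratedFDeriv ℝ n f (t - x)‖) := by
      rw [mul_pow]; ring
    _ ≤ _ := mul_le_mul_of_nonneg_left h1 (by positivity)

theorem seminorm_translation_le (k n : ℕ) (f : 𝓢(V, ℂ)) (x : V) :
    SchwartzMap.seminorm ℂ k n (translation x f) ≤
      (1 + ‖x‖) ^ k * (2 ^ k * (Finset.Iic (k, n)).sup (schwartzSeminormFamily ℂ V ℂ) f) := by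
  refine SchwartzMap.seminorm_le_bound ℂ k n _ (by positivity) fun t ↦ ?_
  have : iteratedFDeriv ℝ n (translation x f) t = iteratedFDeriv ℝ n f (t - x) :=
    iteratedFDeriv_comp_sub n x t
  rw [this]
  exact norm_pow_mul_norm_iteratedFDeriv_sub_le k n f t x

theorem exists_seminorm_translation_le (p : Seminorm ℂ 𝓢(V, ℂ)) (hp : Continuous p) :
    ∃ (q : Seminorm ℂ 𝓢(V, ℂ)) (m : ℕ), Continuous q ∧
      ∀ x f, p (translation x f) ≤ (1 + ‖x‖) ^ m * q f := by
  obtain ⟨k, n, C, h⟩ := exists_le_sup_seminorm p hp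
  set r := (Finset.Iic (k, n)).sup (schwartzSeminormFamily ℂ V ℂ) with hr
  refine ⟨(C * 2 ^ k) • r, k, ?_, fun x f ↦ ?_⟩
  · exact (continuous_const.mul (continuous_sup_seminorm _) :
      Continuous fun f ↦ ((C * 2 ^ k : NNReal) : ℝ) * r f)
  change _ ≤ (1 + ‖x‖) ^ k * (((C * 2 ^ k : NNReal) : ℝ) * r f)
  have h1 : r (translation x f) ≤ (1 + ‖x‖) ^ k * (2 ^ k * r f) := by
    refine Seminorm.finset_sup_apply_le (by positivity) ?_
    rintro ⟨i, j⟩ hij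
    obtain ⟨hi, hj⟩ := Prod.mk_le_mk.1 (Finset.mem_Iic.1 hij)
    refine (seminorm_translation_le i j f x).trans ?_
    have hm : (Finset.Iic (i, j)).sup (schwartzSeminormFamily ℂ V ℂ) f ≤ r f :=
      (Finset.sup_mono (Finset.Iic_subset_Iic.2 (Prod.mk_le_mk.2 ⟨hi, hj⟩)) : _ ≤ r) f
    gcongr
    · simp
    · norm_num
  calc _ ≤ C * r (translation x f) := h _
    _ ≤ C * ((1 + ‖x‖) ^ k * (2 ^ k * r f)) := by gcongr
    _ = _ := by push_cast; ring

/-- The mean value inequality bounds the difference of two translates in the seminorm `(k, n)` by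
`‖x - x₀‖` times a constant involving one more derivative, hence the index `(k, n + 1)`. -/
theorem continuous_translation (f : 𝓢(V, ℂ)) : Continuous fun x ↦ translation x f := by
  rw [continuous_iff_continuousAt]
  intro x₀
  rw [ContinuousAt, (schwartz_withSeminorms ℂ V ℂ).tendsto_nhds]
  rintro ⟨k, n⟩ ε hε
  set r := (Finset.Iic (k, n + 1)).sup (schwartzSeminormFamily ℂ V ℂ) f
  set M := (2 + ‖x₀‖) ^ k * (2 ^ k * r)
  have hM : 0 ≤ M := by positivity
  have key : ∀ x, ‖x - x₀‖ < 1 →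
      SchwartzMap.seminorm ℂ k n (translation x f - translation x₀ f) ≤ M * ‖x - x₀‖ := by
    intro x hx
    refine SchwartzMap.seminorm_le_bound ℂ k n _ (by positivity) fun t ↦ ?_
    have e : iteratedFDeriv ℝ n (translation x f - translation x₀ f : 𝓢(V, ℂ)) t =
        iteratedFDeriv ℝ n f (t - x) - iteratedFDeriv ℝ n f (t - x₀) := by
      have h1 : iteratedFDeriv ℝ n (translation x f) t = iteratedFDeriv ℝ n f (t - x) :=
        iteratedFDeriv_comp_sub n x t
      have h2 : iteratedFDeriv ℝ n (translation x₀ f) t = iteratedFDeriv ℝ n f (t - x₀) :=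
        iteratedFDeriv_comp_sub n x₀ t
      rw [← h1, ← h2]
      exact iteratedFDeriv_sub_apply ((translation x f).contDiffAt n)
        ((translation x₀ f).contDiffAt n)
    rw [e]
    have hd : ∀ y, DifferentiableAt ℝ (fun y ↦ ‖t‖ ^ k • iteratedFDeriv ℝ n f y) y := fun y ↦
      (((f.smooth ⊤).differentiable_iteratedFDeriv (m := n)
        (by exact_mod_cast ENat.natCast_lt_top n)) y).fun_const_smul _
    -- The weight `‖t‖ ^ k` is a constant in `y`, so only the derivative of order `n` is
    -- differentiated along the segment.
    have := (convex_segment (t - x) (t - x₀)).norm_image_sub_le_of_norm_fderiv_le (𝕜 := ℝ)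
      (f := fun y ↦ ‖t‖ ^ k • iteratedFDeriv ℝ n f y) (C := M) (fun y _ ↦ hd y) ?_
      (right_mem_segment ℝ _ _) (left_mem_segment ℝ _ _)
    · rw [← smul_sub, norm_smul, norm_pow, norm_norm] at this
      refine this.trans_eq ?_
      rw [show t - x - (t - x₀) = -(x - x₀) by abel, norm_neg]
    · intro y hy
      have hdiff := ((f.smooth ⊤).differentiable_iteratedFDeriv (m := n)
        (by exact_mod_cast ENat.natCast_lt_top n)) y
      rw [fderiv_fun_const_smul hdiff, norm_smul, norm_fderiv_iteratedFDeriv, norm_pow, norm_norm]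
      obtain ⟨a, b, ha, hb, hab, rfl⟩ := hy
      have hb1 : b = 1 - a := by linarith
      have e2 : a • (t - x) + b • (t - x₀) = t - (x₀ + a • (x - x₀)) := by
        rw [hb1]; module
      rw [e2]
      refine (norm_pow_mul_norm_iteratedFDeriv_sub_le k (n + 1) f t _).trans ?_
      have : ‖x₀ + a • (x - x₀)‖ ≤ ‖x₀‖ + 1 := by
        refine (norm_add_le _ _).trans ?_
        rw [norm_smul, Real.norm_of_nonneg ha]
        have : a ≤ 1 := by linarith
        nlinarith [norm_nonneg (x - x₀)]
      exact mul_le_mul_of_nonneg_right (pow_le_pow_left₀ (by positivity) (by linarith) k)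
        (by positivity)
  have h0 : Tendsto (fun x ↦ M * ‖x - x₀‖) (𝓝 x₀) (𝓝 0) := by
    have : Continuous fun x ↦ M * ‖x - x₀‖ := by fun_prop
    simpa using this.tendsto x₀
  filter_upwards [h0.eventually (gt_mem_nhds hε), Metric.ball_mem_nhds x₀ one_pos] with x h1 h2
  exact (key x (by rwa [← dist_eq_norm])).trans_lt h1

/-- The time-frequency shift `M_ξ T_x φ` of a window by `z = (x, ξ)`. -/
def atom (z : V × V) (φ : 𝓢(V, ℂ)) : 𝓢(V, ℂ) := modulation z.2 (translation z.1 φ)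

theorem atom_apply (z : V × V) (φ : 𝓢(V, ℂ)) (t : V) :
    atom z φ t = Complex.exp (((inner ℝ t z.2 : ℝ) : ℂ) * Complex.I) * φ (t - z.1) :=
  modulation_apply _ _ _

theorem norm_atom_apply (z : V × V) (φ : 𝓢(V, ℂ)) (t : V) : ‖atom z φ t‖ = ‖φ (t - z.1)‖ := by
  rw [atom_apply, norm_mul, Complex.norm_exp_ofReal_mul_I, one_mul]

end Translation

/-! ### Modulations and time-frequency shifts. -/

section Modulation

variable {V : Type*} [NormedAddCommGroup V] [InnerProductSpace ℝ V] [FiniteDimensional ℝ V]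
  [MeasurableSpace V] [BorelSpace V]

/-- Modulations are conjugate to translations under the Fourier transform. -/
theorem modulation_eq_fourierInv (ξ : V) (f : 𝓢(V, ℂ)) :
    modulation ξ f = 𝓕⁻ (translation ((2 * Real.pi)⁻¹ • ξ) (𝓕 f)) := by
  ext t
  have hpi := Real.pi_ne_zero
  have hf : f t = 𝓕⁻ (𝓕 f) t := by rw [FourierTransform.fourierInv_fourier_eq]
  rw [modulation_apply, hf, SchwartzMap.fourierInv_coe, SchwartzMap.fourierInv_coe,
    Real.fourierInv_eq', Real.fourierInv_eq', ← integral_const_mul,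
    ← integral_sub_right_eq_self _ ((2 * Real.pi)⁻¹ • ξ)]
  congr 1
  ext w
  rw [translation_apply, smul_eq_mul, smul_eq_mul, ← mul_assoc, ← Complex.exp_add]
  congr 2
  rw [← add_mul, ← Complex.ofReal_add, inner_sub_left, inner_smul_left, real_inner_comm]
  congr 2
  simp only [conj_trivial]
  field_simp
  ring

theorem exists_seminorm_modulation_le (p : Seminorm ℂ 𝓢(V, ℂ)) (hp : Continuous p) :
    ∃ (q : Seminorm ℂ 𝓢(V, ℂ)) (m : ℕ), Continuous q ∧
      ∀ ξ f, p (modulation ξ f) ≤ (1 + ‖ξ‖) ^ m * q f := by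
  obtain ⟨q, m, hq, h⟩ := exists_seminorm_translation_le
    (p.comp (FourierTransform.fourierInvCLM ℂ 𝓢(V, ℂ) (F := 𝓢(V, ℂ))).toLinearMap)
    (hp.comp (FourierTransform.fourierInvCLM ℂ 𝓢(V, ℂ) (F := 𝓢(V, ℂ))).continuous)
  refine ⟨q.comp (FourierTransform.fourierCLM ℂ 𝓢(V, ℂ) (F := 𝓢(V, ℂ))).toLinearMap, m,
    hq.comp (FourierTransform.fourierCLM ℂ 𝓢(V, ℂ) (F := 𝓢(V, ℂ))).continuous, fun ξ f ↦ ?_⟩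
  rw [modulation_eq_fourierInv]
  refine (h ((2 * Real.pi)⁻¹ • ξ) (𝓕 f)).trans ?_
  have h1 : ‖(2 * Real.pi)⁻¹ • ξ‖ ≤ ‖ξ‖ := by
    rw [norm_smul]
    refine mul_le_of_le_one_left (norm_nonneg _) ?_
    rw [Real.norm_of_nonneg (by positivity)]
    exact inv_le_one_of_one_le₀ (by nlinarith [Real.pi_gt_three])
  exact mul_le_mul_of_nonneg_right (by gcongr) (apply_nonneg q _)

theorem continuous_modulation (f : 𝓢(V, ℂ)) : Continuous fun ξ ↦ modulation ξ f := by
  simp_rw [modulation_eq_fourierInv]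
  exact (FourierTransform.fourierInvCLM ℂ 𝓢(V, ℂ) (F := 𝓢(V, ℂ))).continuous.comp
    ((continuous_translation _).comp (continuous_const_smul _))

theorem exists_seminorm_atom_le (p : Seminorm ℂ 𝓢(V, ℂ)) (hp : Continuous p) :
    ∃ (q : Seminorm ℂ 𝓢(V, ℂ)) (m : ℕ), Continuous q ∧
      ∀ z φ, p (atom z φ) ≤ (1 + ‖z‖) ^ m * q φ := by
  obtain ⟨q, m, hq, h⟩ := exists_seminorm_modulation_le p hp
  obtain ⟨r, l, hr, h'⟩ := exists_seminorm_translation_le q hq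
  refine ⟨r, m + l, hr, fun z φ ↦ (h _ _).trans ?_⟩
  have h1 := norm_fst_le z
  have h2 := norm_snd_le z
  calc _ ≤ (1 + ‖z.2‖) ^ m * ((1 + ‖z.1‖) ^ l * r φ) := by gcongr; exact h' _ _
    _ ≤ (1 + ‖z‖) ^ m * ((1 + ‖z‖) ^ l * r φ) := by
      have := apply_nonneg r φ
      gcongr
    _ = _ := by ring

theorem continuous_atom (φ : 𝓢(V, ℂ)) : Continuous fun z : V × V ↦ atom z φ := by
  rw [continuous_iff_continuousAt]
  intro z₀
  rw [ContinuousAt, (schwartz_withSeminorms ℂ V ℂ).tendsto_nhds]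
  intro i ε hε
  have hp := (schwartz_withSeminorms ℂ V ℂ).continuous_seminorm i
  obtain ⟨q, m, hq, h⟩ := exists_seminorm_modulation_le _ hp
  have hc : Continuous fun z : V × V ↦ (1 + ‖z.2‖) ^ m *
      q (translation z.1 φ - translation z₀.1 φ) + schwartzSeminormFamily ℂ V ℂ i
        (modulation z.2 (translation z₀.1 φ) - modulation z₀.2 (translation z₀.1 φ)) := by
    have h1 : Continuous fun z : V × V ↦ translation z.1 φ - translation z₀.1 φ :=
      ((continuous_translation φ).comp continuous_fst).sub continuous_const
    have h2 : Continuous fun z : V × V ↦ modulation z.2 (translation z₀.1 φ) -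
        modulation z₀.2 (translation z₀.1 φ) :=
      ((continuous_modulation _).comp continuous_snd).sub continuous_const
    exact ((by fun_prop : Continuous fun z : V × V ↦ (1 + ‖z.2‖) ^ m).mul (hq.comp h1)).add
      (hp.comp h2)
  have h0 := hc.tendsto z₀
  simp only [sub_self, map_zero, mul_zero, add_zero] at h0
  filter_upwards [h0.eventually (gt_mem_nhds hε)] with z hz
  refine lt_of_le_of_lt ?_ hz
  -- In the first summand the modulation varies, but it is controlled by a locally bounded factor;
  -- in the second the modulated function is fixed.
  have e : atom z φ - atom z₀ φ = modulation z.2 (translation z.1 φ - translation z₀.1 φ) +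
      (modulation z.2 (translation z₀.1 φ) - modulation z₀.2 (translation z₀.1 φ)) := by
    rw [map_sub]; unfold atom; abel
  rw [e]
  exact (map_add_le_add _ _ _).trans (add_le_add (h _ _) le_rfl)

end Modulation

/-! ### Weak integrals with values in the Schwartz space. -/

section SchwartzIntegral

variable {E : Type*} [NormedAddCommGroup E] [NormedSpace ℝ E]

open scoped BoundedContinuousFunction

variable (E) in
/-- Bounded continuous functions with values in the `n`-linear maps on `E`. -/
def DerivBCF (n : ℕ) : Type _ :=
  @BoundedContinuousFunction E (E [×n]→L[ℝ] ℂ) _ SeminormedAddCommGroup.toPseudoMetricSpace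

instance (n : ℕ) : NormedAddCommGroup (DerivBCF E n) :=
  inferInstanceAs (NormedAddCommGroup (@BoundedContinuousFunction E (E [×n]→L[ℝ] ℂ) _
    SeminormedAddCommGroup.toPseudoMetricSpace))

instance (n : ℕ) : NormedSpace ℂ (DerivBCF E n) :=
  inferInstanceAs (NormedSpace ℂ (@BoundedContinuousFunction E (E [×n]→L[ℝ] ℂ) _
    SeminormedAddCommGroup.toPseudoMetricSpace))

instance (n : ℕ) : CompleteSpace (DerivBCF E n) :=
  inferInstanceAs (CompleteSpace (@BoundedContinuousFunction E (E [×n]→L[ℝ] ℂ) _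
    SeminormedAddCommGroup.toPseudoMetricSpace))

/-- Evaluation at a point. -/
def DerivBCF.eval {n : ℕ} (t : E) : DerivBCF E n →L[ℂ] (E [×n]→L[ℝ] ℂ) :=
  LinearMap.mkContinuous
    { toFun := fun b ↦ BoundedContinuousFunction.toContinuousMap b t
      map_add' := fun _ _ ↦ rfl
      map_smul' := fun _ _ ↦ rfl } 1 fun b ↦ by
    rw [one_mul]; exact BoundedContinuousFunction.norm_coe_le_norm b t

theorem DerivBCF.norm_eval_le {n : ℕ} (t : E) (b : DerivBCF E n) : ‖DerivBCF.eval t b‖ ≤ ‖b‖ :=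
  BoundedContinuousFunction.norm_coe_le_norm b t

theorem DerivBCF.ext {n : ℕ} {a b : DerivBCF E n}
    (h : ∀ t, DerivBCF.eval t a = DerivBCF.eval t b) : a = b :=
  BoundedContinuousFunction.ext h

/-- The bounded continuous function `t ↦ ‖t‖ ^ k • D^n f t`, whose norm is the Schwartz
seminorm of `f` with index `(k, n)`. -/
def weightedDeriv (k n : ℕ) (f : 𝓢(E, ℂ)) : DerivBCF E n :=
  BoundedContinuousFunction.ofNormedAddCommGroup (fun t ↦ ‖t‖ ^ k • iteratedFDeriv ℝ n f t)
    ((by fun_prop : Continuous fun t : E ↦ ‖t‖ ^ k).smul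
      ((f.smooth ⊤).continuous_iteratedFDeriv (by exact_mod_cast le_top)))
    (SchwartzMap.seminorm ℂ k n f) fun t ↦ by
      rw [norm_smul, norm_pow, norm_norm]; exact SchwartzMap.le_seminorm ℂ k n f t

theorem eval_weightedDeriv (k n : ℕ) (f : 𝓢(E, ℂ)) (t : E) :
    DerivBCF.eval t (weightedDeriv k n f) = ‖t‖ ^ k • iteratedFDeriv ℝ n f t := rfl

theorem norm_weightedDeriv_le (k n : ℕ) (f : 𝓢(E, ℂ)) :
    ‖weightedDeriv k n f‖ ≤ SchwartzMap.seminorm ℂ k n f :=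
  BoundedContinuousFunction.norm_ofNormedAddCommGroup_le _ (apply_nonneg _ _) _

theorem seminorm_le_norm_weightedDeriv (k n : ℕ) (f : 𝓢(E, ℂ)) :
    SchwartzMap.seminorm ℂ k n f ≤ ‖weightedDeriv k n f‖ := by
  refine SchwartzMap.seminorm_le_bound ℂ k n f (norm_nonneg (weightedDeriv k n f)) fun t ↦ ?_
  have := DerivBCF.norm_eval_le t (weightedDeriv k n f)
  rwa [eval_weightedDeriv, norm_smul, norm_pow, norm_norm] at this

/-- `weightedDeriv` as a linear map. -/
def weightedDerivLM (k n : ℕ) : 𝓢(E, ℂ) →ₗ[ℂ] DerivBCF E n where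
  toFun := weightedDeriv k n
  map_add' f g := by
    refine DerivBCF.ext fun t ↦ ?_
    have : iteratedFDeriv ℝ n (f + g : 𝓢(E, ℂ)) t =
        iteratedFDeriv ℝ n f t + iteratedFDeriv ℝ n g t :=
      iteratedFDeriv_add_apply (f.contDiffAt n) (g.contDiffAt n)
    simp only [eval_weightedDeriv, map_add, this, smul_add]
  map_smul' c f := by
    refine DerivBCF.ext fun t ↦ ?_
    have : iteratedFDeriv ℝ n (c • f : 𝓢(E, ℂ)) t = c • iteratedFDeriv ℝ n f t :=
      iteratedFDeriv_const_smul_apply (f.contDiffAt n)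
    simp only [eval_weightedDeriv, map_smul, this, RingHom.id_apply]
    rw [smul_comm]

/-- `weightedDeriv` as a continuous linear map. -/
def weightedDerivCLM (k n : ℕ) : 𝓢(E, ℂ) →L[ℂ] DerivBCF E n where
  toLinearMap := weightedDerivLM k n
  cont := WithSeminorms.continuous_normedSpace_rng _ (schwartz_withSeminorms ℂ E ℂ)
    (weightedDerivLM k n) ⟨{(k, n)}, 1, fun f ↦ 
      (norm_weightedDeriv_le k n f).trans_eq (by simp)⟩

theorem eval_weightedDerivCLM (k n : ℕ) (f : 𝓢(E, ℂ)) (t : E) :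
    DerivBCF.eval t (weightedDerivCLM k n f) = ‖t‖ ^ k • iteratedFDeriv ℝ n f t := rfl

/-- A linear functional dominated by `‖J ·‖` factors continuously through `J`. -/
theorem exists_continuous_factor {X B : Type*} [AddCommGroup X] [Module ℂ X]
    [NormedAddCommGroup B] [NormedSpace ℂ B] (J : X →ₗ[ℂ] B) (u : X →ₗ[ℂ] ℂ) (C : ℝ)
    (h : ∀ f, ‖u f‖ ≤ C * ‖J f‖) : ∃ L : B →L[ℂ] ℂ, ∀ f, L (J f) = u f := by
  -- The bound forces `u` to vanish on the kernel of `J`, so `u` factors algebraically; on the range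
  -- of `J` the factor is bounded, and Hahn–Banach extends it.
  have hu : u ∈ J.dualMap.range := by
    rw [LinearMap.range_dualMap_eq_dualAnnihilator_ker, Submodule.mem_dualAnnihilator]
    intro f hf
    have := h f
    rw [LinearMap.mem_ker.1 hf, norm_zero, mul_zero] at this
    exact norm_le_zero_iff.1 this
  obtain ⟨l, hl⟩ := hu
  let l₀ : StrongDual ℂ J.range := (l.domRestrict J.range).mkContinuous C (by
    rintro ⟨-, f, rfl⟩
    have : l (J f) = u f := by rw [← hl]; rfl
    simpa [this] using h f)
  obtain ⟨L, hL, -⟩ := exists_extension_norm_eq J.range l₀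
  refine ⟨L, fun f ↦ ?_⟩
  rw [hL ⟨J f, LinearMap.mem_range_self J f⟩, ← hl]
  rfl

theorem norm_smul_iteratedFDeriv_le {Z : Type*} {H : Z → ℂ} {F : Z → 𝓢(E, ℂ)} (n : ℕ)
    (t : E) (z : Z) :
    ‖H z • iteratedFDeriv ℝ n (F z) t‖ ≤ ‖H z‖ * SchwartzMap.seminorm ℂ 0 n (F z) := by
  rw [norm_smul]
  exact mul_le_mul_of_nonneg_left (SchwartzMap.norm_iteratedFDeriv_le_seminorm ℂ _ n t)
    (norm_nonneg _)

variable {Z : Type*} [TopologicalSpace Z] [SecondCountableTopology Z] [MeasurableSpace Z]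
  [OpensMeasurableSpace Z] {μ : Measure Z} {H : Z → ℂ} {F : Z → 𝓢(E, ℂ)}

theorem integrable_smul_weightedDerivCLM (hH : AEStronglyMeasurable H μ) (hF : Continuous F)
    (hint : ∀ k n, Integrable (fun z ↦ ‖H z‖ * SchwartzMap.seminorm ℂ k n (F z)) μ) (k n : ℕ) :
    Integrable (fun z ↦ H z • weightedDerivCLM k n (F z)) μ := by
  refine (hint k n).mono' (hH.smul
    ((weightedDerivCLM k n).continuous.comp hF).aestronglyMeasurable) (ae_of_all _ fun z ↦ ?_)
  rw [norm_smul]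
  exact mul_le_mul_of_nonneg_left (norm_weightedDeriv_le k n _) (norm_nonneg _)

theorem integrable_smul_iteratedFDeriv (hH : AEStronglyMeasurable H μ) (hF : Continuous F)
    (hint : ∀ k n, Integrable (fun z ↦ ‖H z‖ * SchwartzMap.seminorm ℂ k n (F z)) μ) (n : ℕ)
    (t : E) : Integrable (fun z ↦ H z • iteratedFDeriv ℝ n (F z) t) μ := by
  have := (DerivBCF.eval t).integrable_comp
    (integrable_smul_weightedDerivCLM hH hF hint 0 n)
  refine this.congr (ae_of_all _ fun z ↦ ?_)
  simp [eval_weightedDerivCLM]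

/-- Differentiation under the integral sign: the integrand of order `m + 1` is dominated, uniformly
in `t`, by `‖H z‖` times the seminorm `(0, m + 1)` of `F z`. Currying turns that integrand into the
derivative of the one of order `m`. -/
theorem hasFTaylorSeriesUpTo_integral (hH : AEStronglyMeasurable H μ) (hF : Continuous F)
    (hint : ∀ k n, Integrable (fun z ↦ ‖H z‖ * SchwartzMap.seminorm ℂ k n (F z)) μ) :
    HasFTaylorSeriesUpTo ∞ (fun t ↦ ∫ z, H z • F z t ∂μ)
      (fun t n ↦ ∫ z, H z • iteratedFDeriv ℝ n (F z) t ∂μ) where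
  zero_eq t := by
    have h := integrable_smul_iteratedFDeriv hH hF hint 0 t
    have := (ContinuousMultilinearMap.apply ℝ (fun _ : Fin 0 ↦ E) ℂ 0).integral_comp_comm h
    simp only [ContinuousMultilinearMap.apply_apply] at this
    rw [ContinuousMultilinearMap.curry0, ← this]
    rfl
  fderiv m _ t := by
    have hi := integrable_smul_iteratedFDeriv hH hF hint (m + 1)
    let L := (continuousMultilinearCurryLeftEquiv ℝ (fun _ : Fin (m + 1) ↦ E) ℂ)
    let L' : (E [×(m + 1)]→L[ℝ] ℂ) →L[ℝ] (E →L[ℝ] (E [×m]→L[ℝ] ℂ)) := L.toContinuousLinearEquiv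
    have e' := ContinuousLinearMap.integral_comp_comm (𝕜 := ℝ) (E := E [×(m + 1)]→L[ℝ] ℂ)
      (Fₗ := E →L[ℝ] (E [×m]→L[ℝ] ℂ)) L' (hi t)
    have e : (∫ z, H z • iteratedFDeriv ℝ (m + 1) (F z) t ∂μ).curryLeft =
        ∫ z, L (H z • iteratedFDeriv ℝ (m + 1) (F z) t) ∂μ :=
      e'.symm
    rw [e]
    refine hasFDerivAt_integral_of_dominated_of_fderiv_le (𝕜 := ℝ)
      (F' := fun t z ↦ L (H z • iteratedFDeriv ℝ (m + 1) (F z) t))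
      (bound := fun z ↦ ‖H z‖ * SchwartzMap.seminorm ℂ 0 (m + 1) (F z)) univ_mem
      (Eventually.of_forall fun y ↦
        (integrable_smul_iteratedFDeriv hH hF hint m y).aestronglyMeasurable)
      (integrable_smul_iteratedFDeriv hH hF hint m t)
      (L.continuous.comp_aestronglyMeasurable (hi t).aestronglyMeasurable)
      (ae_of_all _ fun z y _ ↦ ?_) (hint 0 (m + 1)) (ae_of_all _ fun z y _ ↦ ?_)
    · rw [LinearIsometryEquiv.norm_map]
      exact norm_smul_iteratedFDeriv_le (m + 1) y z
    · have hd := ((F z).smooth ⊤).ftaylorSeries.fderiv m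
        (by exact_mod_cast ENat.natCast_lt_top m) y
      exact hd.fun_const_smul (H z)
  cont m _ := by
    refine continuous_of_dominated
      (fun t ↦ (integrable_smul_iteratedFDeriv hH hF hint m t).aestronglyMeasurable)
      (fun t ↦ ae_of_all _ fun z ↦ norm_smul_iteratedFDeriv_le m t z) (hint 0 m)
      (ae_of_all _ fun z ↦ ?_)
    exact (((F z).smooth ⊤).continuous_iteratedFDeriv (by exact_mod_cast le_top)).fun_const_smul _

/-- Weak integrals in the Schwartz space: an absolutely convergent superposition of Schwartz
functions is a Schwartz function, and tempered distributions commute with the integral. -/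
theorem exists_schwartz_integral (hH : AEStronglyMeasurable H μ) (hF : Continuous F)
    (hint : ∀ k n, Integrable (fun z ↦ ‖H z‖ * SchwartzMap.seminorm ℂ k n (F z)) μ) :
    ∃ G : 𝓢(E, ℂ), (∀ t, G t = ∫ z, H z * F z t ∂μ) ∧
      ∀ u : 𝓢'(E, ℂ), u G = ∫ z, H z * u (F z) ∂μ := by
  have hT := hasFTaylorSeriesUpTo_integral hH hF hint
  have hD : ∀ n t, iteratedFDeriv ℝ n (fun t ↦ ∫ z, H z • F z t ∂μ) t =
      ∫ z, H z • iteratedFDeriv ℝ n (F z) t ∂μ := fun n t ↦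
    (hT.eq_iteratedFDeriv (by exact_mod_cast le_top) t).symm
  have hev : ∀ k n t, DerivBCF.eval t (∫ z, H z • weightedDerivCLM k n (F z) ∂μ) =
      ‖t‖ ^ k • ∫ z, H z • iteratedFDeriv ℝ n (F z) t ∂μ := by
    intro k n t
    have := (DerivBCF.eval t).integral_comp_comm
      (integrable_smul_weightedDerivCLM hH hF hint k n)
    rw [← this, ← integral_smul]
    congr 1
    ext1 z
    simp only [map_smul, eval_weightedDerivCLM]
    rw [smul_comm]
  let G : 𝓢(E, ℂ) :=
    { toFun := fun t ↦ ∫ z, H z • F z t ∂μ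
      smooth' := hT.contDiff
      decay' := fun k n ↦ ⟨‖∫ z, H z • weightedDerivCLM k n (F z) ∂μ‖, fun t ↦ by
        have := DerivBCF.norm_eval_le t (∫ z, H z • weightedDerivCLM k n (F z) ∂μ)
        rwa [hev, norm_smul, norm_pow, norm_norm, ← hD] at this⟩ }
  refine ⟨G, fun t ↦ rfl, fun u ↦ ?_⟩
  obtain ⟨p, hp, hup⟩ := exists_continuous_seminorm_bound (E := E)
    (⟨u.toLinearMap, u.continuous⟩ : 𝓢(E, ℂ) →L[ℂ] ℂ)
  obtain ⟨k, n, C, hC⟩ := exists_le_sup_seminorm p hp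
  -- Finitely many weighted derivatives control `u`. It therefore factors through a Banach space,
  -- where the Bochner integral commutes with continuous functionals.
  let J : 𝓢(E, ℂ) →L[ℂ] (∀ i : Finset.Iic (k, n), DerivBCF E i.1.2) :=
    ContinuousLinearMap.pi fun i ↦ weightedDerivCLM i.1.1 i.1.2
  have hJ : ∀ f, ‖u f‖ ≤ C * ‖J f‖ := fun f ↦ by
    have h1 : ‖u f‖ = p f := hup f
    rw [h1]
    refine (hC f).trans (mul_le_mul_of_nonneg_left ?_ C.2)
    refine Seminorm.finset_sup_apply_le (norm_nonneg _) fun i hi ↦ ?_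
    exact (seminorm_le_norm_weightedDeriv i.1 i.2 f).trans (norm_le_pi_norm (J f) ⟨i, hi⟩)
  have hJ' : ∀ f, ‖u.toLinearMap f‖ ≤ C * ‖J.toLinearMap f‖ := hJ
  obtain ⟨L, hL⟩ := exists_continuous_factor J.toLinearMap u.toLinearMap C hJ'
  have hL' : ∀ f, L (J f) = u f := hL
  have hJint : Integrable (fun z ↦ H z • J (F z)) μ :=
    Integrable.of_eval fun i ↦ integrable_smul_weightedDerivCLM hH hF hint i.1.1 i.1.2
  have hJG : J G = ∫ z, H z • J (F z) ∂μ := by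
    ext1 i
    have := (ContinuousLinearMap.proj (R := ℂ)
      (φ := fun i : Finset.Iic (k, n) ↦ DerivBCF E i.1.2) i).integral_comp_comm hJint
    refine Eq.trans ?_ this
    refine DerivBCF.ext fun t ↦ ?_
    refine Eq.trans ?_ (hev i.1.1 i.1.2 t).symm
    exact (eval_weightedDerivCLM i.1.1 i.1.2 G t).trans (congrArg (‖t‖ ^ i.1.1 • ·) (hD i.1.2 t))
  rw [← hL' G, hJG, ← L.integral_comp_comm hJint]
  simp [hL']

end SchwartzIntegral

/-! ### Rapid decay and polynomial growth. -/

section Decay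

variable {X : Type*} [NormedAddCommGroup X]

/-- Decay faster than any power. -/
def RapidDecay (H : X → ℂ) : Prop := ∀ N : ℕ, ∃ C : ℝ, ∀ z, (1 + ‖z‖) ^ N * ‖H z‖ ≤ C

/-- Growth at most like a power. -/
def PolyGrowth (H : X → ℂ) : Prop := ∃ (m : ℕ) (C : ℝ), ∀ z, ‖H z‖ ≤ C * (1 + ‖z‖) ^ m

theorem RapidDecay.mul_polyGrowth {H G : X → ℂ} (hH : RapidDecay H) (hG : PolyGrowth G) :
    RapidDecay fun z ↦ H z * G z := by
  intro N
  obtain ⟨m, C, hC⟩ := hG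
  obtain ⟨B, hB⟩ := hH (N + m)
  refine ⟨B * |C|, fun z ↦ ?_⟩
  have h1 : ‖G z‖ ≤ |C| * (1 + ‖z‖) ^ m :=
    (hC z).trans (mul_le_mul_of_nonneg_right (le_abs_self C) (by positivity))
  calc (1 + ‖z‖) ^ N * ‖H z * G z‖ ≤ (1 + ‖z‖) ^ N * (‖H z‖ * (|C| * (1 + ‖z‖) ^ m)) := by
        rw [norm_mul]; gcongr
    _ = ((1 + ‖z‖) ^ (N + m) * ‖H z‖) * |C| := by rw [pow_add]; ring
    _ ≤ B * |C| := mul_le_mul_of_nonneg_right (hB z) (abs_nonneg C)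

variable [NormedSpace ℝ X] [FiniteDimensional ℝ X] [MeasurableSpace X] [BorelSpace X]
  (μ : Measure X) [μ.IsAddHaarMeasure]

theorem integrable_inv_one_add_norm_pow {D : ℕ} (hD : Module.finrank ℝ X < D) :
    Integrable (fun z : X ↦ ((1 + ‖z‖) ^ D)⁻¹) μ := by
  have := integrable_one_add_norm (μ := μ) (r := D) (by exact_mod_cast hD)
  refine this.congr (ae_of_all _ fun z ↦ ?_)
  simp only
  rw [Real.rpow_neg (by positivity), Real.rpow_natCast]

theorem RapidDecay.integrable {H : X → ℂ} (hH : RapidDecay H)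
    (hm : AEStronglyMeasurable H μ) : Integrable H μ := by
  obtain ⟨C, hC⟩ := hH (Module.finrank ℝ X + 1)
  refine ((integrable_inv_one_add_norm_pow μ (Nat.lt_succ_self _)).const_mul C).mono' hm
    (ae_of_all _ fun z ↦ ?_)
  rw [← div_eq_mul_inv, le_div_iff₀ (by positivity), mul_comm]
  exact hC z

end Decay

/-! ### Window coefficients of Schwartz functions and their inversion. -/

section WindowCoefficients

variable {V : Type*} [NormedAddCommGroup V] [InnerProductSpace ℝ V]

theorem conjugate_conjugate (f : 𝓢(V, ℂ)) : conjugate (conjugate f) = f := by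
  ext t; simp [conjugate_apply]

theorem conjugate_ne_zero {φ : 𝓢(V, ℂ)} (h : φ ≠ 0) : conjugate φ ≠ 0 := by
  intro h0
  apply h
  rw [← conjugate_conjugate φ, h0]
  ext t
  simp [conjugate_apply]

theorem conjugate_atom (z : V × V) (φ : 𝓢(V, ℂ)) :
    conjugate (atom z φ) = atom (z.1, -z.2) (conjugate φ) := by
  ext t
  simp [conjugate_apply, atom_apply, ← Complex.exp_conj]

/-- Multiplication with a translated window. -/
def mulTranslate (φ f : 𝓢(V, ℂ)) (x : V) : 𝓢(V, ℂ) := SchwartzMap.smulLeftCLM ℂ (translation x φ) f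

theorem mulTranslate_apply (φ f : 𝓢(V, ℂ)) (x t : V) :
    mulTranslate φ f x t = φ (t - x) * f t := by
  simp [mulTranslate, SchwartzMap.hasTemperateGrowth, translation_apply]

/-- By `1 + ‖x‖ ≤ (1 + ‖t - x‖) * (1 + ‖t‖)`, a power of `1 + ‖x‖` is paid for by the decay of the
translated window and of `f`; the Leibniz rule gives `2 ^ n`. -/
theorem seminorm_mulTranslate_le (φ f : 𝓢(V, ℂ)) (x : V) (N k n : ℕ) :
    (1 + ‖x‖) ^ N * SchwartzMap.seminorm ℂ k n (mulTranslate φ f x) ≤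
      2 ^ n * ((2 ^ N * (Finset.Iic (N, n)).sup (schwartzSeminormFamily ℂ V ℂ) φ) *
        (2 ^ (k + N) * (Finset.Iic (k + N, n)).sup (schwartzSeminormFamily ℂ V ℂ) f)) := by
  set A := 2 ^ N * (Finset.Iic (N, n)).sup (schwartzSeminormFamily ℂ V ℂ) φ
  set B := 2 ^ (k + N) * (Finset.Iic (k + N, n)).sup (schwartzSeminormFamily ℂ V ℂ) f
  have hA : 0 ≤ A := by positivity
  have hB : 0 ≤ B := by positivity
  have hx : 0 < (1 + ‖x‖) ^ N := by positivity
  rw [mul_comm, ← le_div_iff₀ hx]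
  refine SchwartzMap.seminorm_le_bound ℂ k n _ (by positivity) fun t ↦ ?_
  rw [le_div_iff₀ hx]
  have hfun : (mulTranslate φ f x : V → ℂ) = fun t ↦ translation x φ t * f t := by
    ext t; rw [mulTranslate_apply]; rfl
  rw [hfun]
  have hmul := norm_iteratedFDeriv_mul_le ((translation x φ).smooth ⊤) (f.smooth ⊤) t (n := n)
    (by exact_mod_cast le_top)
  have hxt : 1 + ‖x‖ ≤ (1 + ‖t - x‖) * (1 + ‖t‖) := by
    have : ‖x‖ ≤ ‖t‖ + ‖t - x‖ := by simpa using norm_sub_le t (t - x)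
    nlinarith [mul_nonneg (norm_nonneg (t - x)) (norm_nonneg t)]
  have hterm : ∀ i ∈ Finset.range (n + 1),
      ‖t‖ ^ k * ((n.choose i : ℝ) * ‖iteratedFDeriv ℝ i (translation x φ) t‖ *
        ‖iteratedFDeriv ℝ (n - i) f t‖) * (1 + ‖x‖) ^ N ≤ (n.choose i : ℝ) * (A * B) := by
    intro i hi
    have hi' : i ≤ n := Nat.lt_succ_iff.mp (Finset.mem_range.mp hi)
    have e : iteratedFDeriv ℝ i (translation x φ) t = iteratedFDeriv ℝ i φ (t - x) :=
      iteratedFDeriv_comp_sub i x t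
    have h1 : (1 + ‖t - x‖) ^ N * ‖iteratedFDeriv ℝ i φ (t - x)‖ ≤ A :=
      SchwartzMap.one_add_le_sup_seminorm_apply (𝕜 := ℂ) (m := (N, n)) le_rfl hi' φ (t - x)
    have h2 : (1 + ‖t‖) ^ (k + N) * ‖iteratedFDeriv ℝ (n - i) f t‖ ≤ B :=
      SchwartzMap.one_add_le_sup_seminorm_apply (𝕜 := ℂ) (m := (k + N, n)) le_rfl
        (Nat.sub_le n i) f t
    rw [e]
    calc _ ≤ (1 + ‖t‖) ^ k * ((n.choose i : ℝ) * ‖iteratedFDeriv ℝ i φ (t - x)‖ *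
            ‖iteratedFDeriv ℝ (n - i) f t‖) * ((1 + ‖t - x‖) * (1 + ‖t‖)) ^ N := by
          gcongr; linarith
      _ = (n.choose i : ℝ) * (((1 + ‖t - x‖) ^ N * ‖iteratedFDeriv ℝ i φ (t - x)‖) *
            ((1 + ‖t‖) ^ (k + N) * ‖iteratedFDeriv ℝ (n - i) f t‖)) := by
          rw [mul_pow, pow_add]; ring
      _ ≤ _ := by gcongr
  calc _ ≤ ‖t‖ ^ k * (∑ i ∈ Finset.range (n + 1), (n.choose i : ℝ) *
        ‖iteratedFDeriv ℝ i (translation x φ) t‖ * ‖iteratedFDeriv ℝ (n - i) f t‖) *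
          (1 + ‖x‖) ^ N := by gcongr
    _ = ∑ i ∈ Finset.range (n + 1), ‖t‖ ^ k * ((n.choose i : ℝ) *
        ‖iteratedFDeriv ℝ i (translation x φ) t‖ * ‖iteratedFDeriv ℝ (n - i) f t‖) *
          (1 + ‖x‖) ^ N := by rw [Finset.mul_sum, Finset.sum_mul]
    _ ≤ ∑ i ∈ Finset.range (n + 1), (n.choose i : ℝ) * (A * B) := Finset.sum_le_sum hterm
    _ = 2 ^ n * (A * B) := by
      rw [← Finset.sum_mul]
      congr 1
      exact_mod_cast Nat.sum_range_choose n

theorem exists_seminorm_mulTranslate_le (φ : 𝓢(V, ℂ)) (N : ℕ) (p : Seminorm ℂ 𝓢(V, ℂ))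
    (hp : Continuous p) : ∃ q : Seminorm ℂ 𝓢(V, ℂ), Continuous q ∧
      ∀ f x, (1 + ‖x‖) ^ N * p (mulTranslate φ f x) ≤ q f := by
  obtain ⟨k, n, C, h⟩ := exists_le_sup_seminorm p hp
  set r : Seminorm ℂ 𝓢(V, ℂ) := (Finset.Iic (k + N, n)).sup (schwartzSeminormFamily ℂ V ℂ) with hr
  set a := (Finset.Iic (N, n)).sup (schwartzSeminormFamily ℂ V ℂ) φ
  have ha : 0 ≤ a := apply_nonneg _ _
  let c : NNReal := C * (2 ^ n * ((2 ^ N * Real.toNNReal a) * 2 ^ (k + N)))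
  have hc : (c : ℝ) = C * (2 ^ n * ((2 ^ N * a) * 2 ^ (k + N))) := by
    simp [c, Real.coe_toNNReal a ha]
  refine ⟨c • r, (continuous_const.mul (continuous_sup_seminorm _) :
      Continuous fun f ↦ (c : ℝ) * r f), fun f x ↦ ?_⟩
  change _ ≤ (c : ℝ) * r f
  have hx : 0 < (1 + ‖x‖) ^ N := by positivity
  have h1 : (Finset.Iic (k, n)).sup (schwartzSeminormFamily ℂ V ℂ) (mulTranslate φ f x) ≤
      2 ^ n * ((2 ^ N * a) * (2 ^ (k + N) * r f)) / (1 + ‖x‖) ^ N := by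
    refine Seminorm.finset_sup_apply_le (by positivity) ?_
    rintro ⟨i, j⟩ hij
    obtain ⟨hi, hj⟩ := Prod.mk_le_mk.1 (Finset.mem_Iic.1 hij)
    rw [le_div_iff₀ hx, mul_comm]
    refine (seminorm_mulTranslate_le φ f x N i j).trans ?_
    have hm : (Finset.Iic (i + N, j)).sup (schwartzSeminormFamily ℂ V ℂ) f ≤ r f :=
      (Finset.sup_mono (Finset.Iic_subset_Iic.2 (Prod.mk_le_mk.2 ⟨by lia, hj⟩)) : _ ≤ r) f
    have hm' : (Finset.Iic (N, j)).sup (schwartzSeminormFamily ℂ V ℂ) φ ≤ a :=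
      (Finset.sup_mono (Finset.Iic_subset_Iic.2 (Prod.mk_le_mk.2 ⟨le_rfl, hj⟩)) :
        _ ≤ (Finset.Iic (N, n)).sup (schwartzSeminormFamily ℂ V ℂ)) φ
    gcongr <;> norm_num
  calc _ ≤ (1 + ‖x‖) ^ N * (C * (2 ^ n * ((2 ^ N * a) * (2 ^ (k + N) * r f)) /
        (1 + ‖x‖) ^ N)) := by
        gcongr
        exact (h _).trans (mul_le_mul_of_nonneg_left h1 C.2)
    _ = _ := by rw [hc]; field_simp

variable [FiniteDimensional ℝ V] [MeasurableSpace V] [BorelSpace V]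

/-- The coefficient `∫ f · M_ξ T_x φ`, where `z = (x, ξ)`. -/
def windowCoeff (φ f : 𝓢(V, ℂ)) (z : V × V) : ℂ := ∫ t, f t * atom z φ t

theorem toTemperedDistributionCLM_atom (φ f : 𝓢(V, ℂ)) (z : V × V) :
    SchwartzMap.toTemperedDistributionCLM V ℂ volume f (atom z φ) = windowCoeff φ f z := by
  refine (SchwartzMap.toTemperedDistributionCLM_apply_apply volume f (atom z φ)).trans ?_
  simp_rw [windowCoeff, smul_eq_mul, mul_comm]

theorem continuous_windowCoeff (φ f : 𝓢(V, ℂ)) : Continuous (windowCoeff φ f) := by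
  simp_rw [← funext (toTemperedDistributionCLM_atom φ f)]
  exact (SchwartzMap.toTemperedDistributionCLM V ℂ volume f).continuous.comp (continuous_atom φ)

theorem windowCoeff_eq_fourier (φ f : 𝓢(V, ℂ)) (x ξ : V) :
    windowCoeff φ f (x, ξ) = 𝓕 (mulTranslate φ f x) ((-(2 * Real.pi)⁻¹) • ξ) := by
  rw [SchwartzMap.fourier_coe, Real.fourier_eq', windowCoeff]
  congr 1
  ext t
  rw [atom_apply, mulTranslate_apply, inner_smul_right, smul_eq_mul]
  have : -2 * Real.pi * (-(2 * Real.pi)⁻¹ * inner ℝ t ξ) = inner ℝ t ξ := by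
    have := Real.pi_ne_zero
    field_simp
  rw [this]
  ring

/-- Decay in position comes from the product with the translated window, decay in frequency from its
Fourier transform being Schwartz. The bound by a continuous seminorm of `f` is what later makes `T
u` continuous. -/
theorem exists_seminorm_windowCoeff_le (φ : 𝓢(V, ℂ)) (N : ℕ) :
    ∃ q : Seminorm ℂ 𝓢(V, ℂ), Continuous q ∧
      ∀ f z, (1 + ‖z‖) ^ N * ‖windowCoeff φ f z‖ ≤ q f := by
  let c : NNReal := (2 * Real.pi).toNNReal ^ N * 2 ^ N
  have hpi : 0 ≤ 2 * Real.pi := by positivity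
  have hc : (c : ℝ) = (2 * Real.pi) ^ N * 2 ^ N := by simp [c, Real.coe_toNNReal _ hpi]
  let r : Seminorm ℂ 𝓢(V, ℂ) := (Finset.Iic (N, 0)).sup (schwartzSeminormFamily ℂ V ℂ)
  let p : Seminorm ℂ 𝓢(V, ℂ) :=
    (c • r).comp (FourierTransform.fourierCLM ℂ 𝓢(V, ℂ) (F := 𝓢(V, ℂ))).toLinearMap
  have hp : Continuous p := (continuous_const.mul (continuous_sup_seminorm _) :
      Continuous fun f ↦ (c : ℝ) * r f).comp
    (FourierTransform.fourierCLM ℂ 𝓢(V, ℂ) (F := 𝓢(V, ℂ))).continuous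
  obtain ⟨q, hq, h⟩ := exists_seminorm_mulTranslate_le φ N p hp
  refine ⟨q, hq, fun f ⟨x, ξ⟩ ↦ le_trans ?_ (h f x)⟩
  rw [windowCoeff_eq_fourier]
  set g := 𝓕 (mulTranslate φ f x)
  set w := (-(2 * Real.pi)⁻¹) • ξ with hw
  have hpg : p (mulTranslate φ f x) = c * r g := rfl
  have h1 : (1 + ‖w‖) ^ N * ‖g w‖ ≤ 2 ^ N * r g := by
    have := SchwartzMap.one_add_le_sup_seminorm_apply (𝕜 := ℂ) (m := (N, 0)) le_rfl le_rfl g w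
    rw [norm_iteratedFDeriv_zero] at this
    exact this
  have h2 : 1 + ‖(x, ξ)‖ ≤ (1 + ‖x‖) * (2 * Real.pi * (1 + ‖w‖)) := by
    have hξ : ‖ξ‖ = 2 * Real.pi * ‖w‖ := by
      rw [hw, norm_smul, norm_neg, norm_inv, Real.norm_of_nonneg hpi]
      field_simp
    have : ‖(x, ξ)‖ ≤ ‖x‖ + ‖ξ‖ := by
      rw [Prod.norm_mk]
      exact max_le (by linarith [norm_nonneg ξ]) (by linarith [norm_nonneg x])
    have hx := norm_nonneg x
    have hw' := norm_nonneg w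
    have h3 := Real.pi_gt_three
    nlinarith [mul_nonneg hx (norm_nonneg ξ), mul_nonneg hx hpi]
  rw [hpg, hc]
  calc _ ≤ ((1 + ‖x‖) * (2 * Real.pi * (1 + ‖w‖))) ^ N * ‖g w‖ := by gcongr
    _ = (1 + ‖x‖) ^ N * ((2 * Real.pi) ^ N * ((1 + ‖w‖) ^ N * ‖g w‖)) := by
      rw [mul_pow, mul_pow]; ring
    _ ≤ (1 + ‖x‖) ^ N * ((2 * Real.pi) ^ N * (2 ^ N * r g)) := by gcongr
    _ = _ := by ring

theorem rapidDecay_windowCoeff (φ f : 𝓢(V, ℂ)) : RapidDecay (windowCoeff φ f) := fun N ↦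
  let ⟨q, _, h⟩ := exists_seminorm_windowCoeff_le φ N
  ⟨q f, h f⟩

instance isAddHaarMeasure_volume_prod : (volume : Measure (V × V)).IsAddHaarMeasure :=
  Measure.prod.instIsAddHaarMeasure _ _

/-- For fixed `x` this is Fourier inversion for `mulTranslate φ f x`; the substitution `w = -ξ /
(2π)` produces the power of `2π`. -/
theorem integral_windowCoeff_mul_frequency (φ f : 𝓢(V, ℂ)) (x t : V) :
    ∫ ξ, windowCoeff φ f (x, ξ) * conjugate (atom (x, ξ) φ) t =
      ((2 * Real.pi) ^ Module.finrank ℝ V : ℝ) * (f t * (‖φ (t - x)‖ ^ 2 : ℝ)) := by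
  have hpi := Real.pi_pos
  set h := mulTranslate φ f x
  have hinv : ∫ w, Complex.exp (((2 * Real.pi * inner ℝ w t : ℝ) : ℂ) * Complex.I) • 𝓕 h w =
      h t := by
    rw [← Real.fourierInv_eq' (𝓕 h : 𝓢(V, ℂ)) t, ← SchwartzMap.fourierInv_coe,
      FourierTransform.fourierInv_fourier_eq]
  have hsub := Measure.integral_comp_smul (volume : Measure V)
    (fun w ↦ Complex.exp (((2 * Real.pi * inner ℝ w t : ℝ) : ℂ) * Complex.I) • 𝓕 h w)
    (-(2 * Real.pi)⁻¹)
  rw [hinv] at hsub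
  have habs : |((-(2 * Real.pi)⁻¹) ^ Module.finrank ℝ V)⁻¹| =
      (2 * Real.pi) ^ Module.finrank ℝ V := by
    rw [abs_inv, abs_pow, abs_neg, abs_inv, abs_of_pos (by positivity), inv_pow, inv_inv]
  rw [habs] at hsub
  have e : ∀ ξ, windowCoeff φ f (x, ξ) * conjugate (atom (x, ξ) φ) t =
      (starRingEnd ℂ) (φ (t - x)) * (Complex.exp (((2 * Real.pi *
        inner ℝ ((-(2 * Real.pi)⁻¹) • ξ) t : ℝ) : ℂ) * Complex.I) •
          𝓕 h ((-(2 * Real.pi)⁻¹) • ξ)) := by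
    intro ξ
    rw [windowCoeff_eq_fourier, conjugate_atom, atom_apply, conjugate_apply, inner_smul_left,
      smul_eq_mul, inner_neg_right, real_inner_comm]
    have : 2 * Real.pi * ((starRingEnd ℝ) (-(2 * Real.pi)⁻¹) * inner ℝ t ξ) = -inner ℝ t ξ := by
      simp only [conj_trivial]; field_simp
    rw [real_inner_comm, this]
    ring
  simp_rw [e]
  rw [integral_const_mul, hsub, mulTranslate_apply, Complex.real_smul]
  have : ((‖φ (t - x)‖ ^ 2 : ℝ) : ℂ) = φ (t - x) * (starRingEnd ℂ) (φ (t - x)) := by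
    rw [Complex.mul_conj, Complex.normSq_eq_norm_sq]
  rw [this]
  ring

/-- The inversion formula for the short-time Fourier transform on Schwartz functions. -/
theorem integral_windowCoeff_mul (φ f : 𝓢(V, ℂ)) (t : V) :
    ∫ z, windowCoeff φ f z * conjugate (atom z φ) t =
      ((2 * Real.pi) ^ Module.finrank ℝ V * ∫ x, ‖φ x‖ ^ 2 : ℝ) * f t := by
  have hcont : Continuous fun z : V × V ↦ conjugate (atom z φ) t := by
    simp_rw [conjugate_apply, atom_apply]
    fun_prop
  have hint : Integrable (fun z ↦ windowCoeff φ f z * conjugate (atom z φ) t) := by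
    refine ((rapidDecay_windowCoeff φ f).mul_polyGrowth
      ⟨0, SchwartzMap.seminorm ℂ 0 0 φ, fun z ↦ ?_⟩).integrable volume
      ((continuous_windowCoeff φ f).mul hcont).aestronglyMeasurable
    rw [conjugate_apply, RCLike.norm_conj, norm_atom_apply, pow_zero, mul_one]
    exact SchwartzMap.norm_le_seminorm ℂ φ _
  rw [Measure.volume_eq_prod] at hint ⊢
  rw [integral_prod _ hint]
  simp_rw [integral_windowCoeff_mul_frequency]
  rw [integral_const_mul, integral_const_mul, integral_complex_ofReal,
    integral_sub_left_eq_self (fun x ↦ ‖φ x‖ ^ 2) volume t]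
  push_cast
  ring

theorem integral_norm_sq_pos {φ : 𝓢(V, ℂ)} (hφ : φ ≠ 0) : 0 < ∫ x, ‖φ x‖ ^ 2 := by
  have hc : Continuous fun x ↦ ‖φ x‖ ^ 2 := by fun_prop
  have hint : Integrable (fun x ↦ ‖φ x‖ ^ 2) := by
    have := (φ.memLp 2 volume).integrable_norm_rpow (by norm_num) (by norm_num)
    simpa using this
  rw [integral_pos_iff_support_of_nonneg (fun x ↦ by positivity) hint]
  obtain ⟨x, hx⟩ : ∃ x, φ x ≠ 0 := by
    by_contra! h
    exact hφ (by ext x; simpa using h x)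
  exact hc.isOpen_support.measure_pos volume ⟨x, by simpa using hx⟩

end WindowCoefficients

/-! ### The reproducing formula, density of Schwartz functions, change of window. -/

section Reproducing

theorem norm_mk_neg {V : Type*} [NormedAddCommGroup V] (z : V × V) : ‖(z.1, -z.2)‖ = ‖z‖ := by
  rw [Prod.norm_mk, norm_neg]; rfl

theorem exists_ne_zero {V : Type*} [NormedAddCommGroup V] [InnerProductSpace ℝ V]
    [FiniteDimensional ℝ V] : ∃ φ : 𝓢(V, ℂ), φ ≠ 0 := by
  let b : ContDiffBump (0 : V) := ⟨1, 2, one_pos, one_lt_two⟩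
  have hs : HasCompactSupport fun t : V ↦ ((b t : ℝ) : ℂ) :=
    b.hasCompactSupport.comp_left (g := fun r : ℝ ↦ (r : ℂ)) Complex.ofReal_zero
  have hd : ContDiff ℝ ∞ fun t : V ↦ ((b t : ℝ) : ℂ) := Complex.ofRealCLM.contDiff.comp b.contDiff
  refine ⟨hs.toSchwartzMap hd, fun h ↦ ?_⟩
  have h0 : hs.toSchwartzMap hd 0 = 0 := by rw [h]; rfl
  have h1 : b 0 = 1 := b.one_of_mem_closedBall (by simp [b])
  have : hs.toSchwartzMap hd 0 = ((b 0 : ℝ) : ℂ) := rfl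
  rw [this, h1] at h0
  simp at h0

variable {V : Type*} [NormedAddCommGroup V] [InnerProductSpace ℝ V] [FiniteDimensional ℝ V]
  [MeasurableSpace V] [BorelSpace V]

theorem continuous_apply_atom (u : 𝓢'(V, ℂ)) (φ : 𝓢(V, ℂ)) : Continuous fun z ↦ u (atom z φ) :=
  u.continuous.comp (continuous_atom φ)

theorem polyGrowth_apply_atom (u : 𝓢'(V, ℂ)) (φ : 𝓢(V, ℂ)) :
    PolyGrowth fun z ↦ u (atom z φ) := by
  obtain ⟨p, hp, hup⟩ := exists_continuous_seminorm_bound (E := V)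
    (⟨u.toLinearMap, u.continuous⟩ : 𝓢(V, ℂ) →L[ℂ] ℂ)
  obtain ⟨q, m, -, h⟩ := exists_seminorm_atom_le p hp
  refine ⟨m, q φ, fun z ↦ ?_⟩
  rw [mul_comm]
  exact (hup (atom z φ)).trans_le (h z φ)

theorem continuous_apply_conjugate_atom (u : 𝓢'(V, ℂ)) (φ : 𝓢(V, ℂ)) :
    Continuous fun z ↦ u (conjugate (atom z φ)) := by
  simp_rw [conjugate_atom]
  exact (continuous_apply_atom u (conjugate φ)).comp (by fun_prop : Continuous fun z : V × V ↦
    (z.1, -z.2))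

theorem polyGrowth_apply_conjugate_atom (u : 𝓢'(V, ℂ)) (φ : 𝓢(V, ℂ)) :
    PolyGrowth fun z ↦ u (conjugate (atom z φ)) := by
  obtain ⟨m, C, h⟩ := polyGrowth_apply_atom u (conjugate φ)
  refine ⟨m, C, fun z ↦ ?_⟩
  change ‖u (conjugate (atom z φ))‖ ≤ _
  rw [conjugate_atom, ← norm_mk_neg z]
  exact h _

/-- The map `g` leaves room for the reflection `(x, ξ) ↦ (x, -ξ)`, which turns conjugates of atoms
into atoms of the conjugate window. -/
theorem exists_synthesis_comp {H : V × V → ℂ} (hm : AEStronglyMeasurable H volume)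
    (hH : RapidDecay H) (φ : 𝓢(V, ℂ)) {g : V × V → V × V} (hg : Continuous g)
    (hgn : ∀ z, ‖g z‖ = ‖z‖) :
    ∃ G : 𝓢(V, ℂ), (∀ t, G t = ∫ z, H z * atom (g z) φ t) ∧
      ∀ u : 𝓢'(V, ℂ), u G = ∫ z, H z * u (atom (g z) φ) := by
  refine exists_schwartz_integral hm ((continuous_atom φ).comp hg) fun k n ↦ ?_
  have hp := (schwartz_withSeminorms ℂ V ℂ).continuous_seminorm (k, n)
  obtain ⟨q, m, -, h⟩ := exists_seminorm_atom_le _ hp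
  have hc : Continuous fun z ↦ SchwartzMap.seminorm ℂ k n (atom (g z) φ) :=
    hp.comp ((continuous_atom φ).comp hg)
  have hdec : RapidDecay fun z ↦ H z * ((SchwartzMap.seminorm ℂ k n (atom (g z) φ) : ℝ) : ℂ) := by
    refine hH.mul_polyGrowth ⟨m, q φ, fun z ↦ ?_⟩
    rw [Complex.norm_real, Real.norm_of_nonneg (apply_nonneg _ _), mul_comm, ← hgn z]
    exact h (g z) φ
  have := (hdec.integrable volume (hm.mul
    (Complex.continuous_ofReal.comp hc).aestronglyMeasurable)).norm
  refine this.congr (ae_of_all _ fun z ↦ ?_)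
  simp only [norm_mul, Complex.norm_real, Real.norm_of_nonneg (apply_nonneg _ _)]

theorem exists_synthesis {H : V × V → ℂ} (hm : AEStronglyMeasurable H volume)
    (hH : RapidDecay H) (φ : 𝓢(V, ℂ)) :
    ∃ G : 𝓢(V, ℂ), ∀ u : 𝓢'(V, ℂ), u G = ∫ z, H z * u (atom z φ) :=
  let ⟨G, _, hG⟩ := exists_synthesis_comp hm hH φ continuous_id fun _ ↦ rfl
  ⟨G, hG⟩

/-- The normalizing constant in the inversion formula. -/
def windowConst (φ : 𝓢(V, ℂ)) : ℂ :=
  (((2 * Real.pi) ^ Module.finrank ℝ V * ∫ x, ‖φ x‖ ^ 2 : ℝ) : ℂ)⁻¹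

/-- A tempered distribution is determined by its short-time Fourier transform. -/
theorem apply_eq_integral_windowCoeff {φ : 𝓢(V, ℂ)} (hφ : φ ≠ 0) (u : 𝓢'(V, ℂ)) (f : 𝓢(V, ℂ)) :
    u f = windowConst φ * ∫ z, windowCoeff φ f z * u (conjugate (atom z φ)) := by
  simp_rw [conjugate_atom]
  obtain ⟨G, hG, hu⟩ := exists_synthesis_comp
    (continuous_windowCoeff φ f).aestronglyMeasurable (rapidDecay_windowCoeff φ f) (conjugate φ)
    (by fun_prop : Continuous fun z : V × V ↦ (z.1, -z.2)) norm_mk_neg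
  have hGf : f = windowConst φ • G := by
    ext t
    have h0 : ((2 * Real.pi) ^ Module.finrank ℝ V * ∫ x, ‖φ x‖ ^ 2 : ℝ) ≠ 0 :=
      (mul_pos (by positivity) (integral_norm_sq_pos hφ)).ne'
    change f t = windowConst φ * G t
    rw [hG]
    simp_rw [← conjugate_atom]
    rw [integral_windowCoeff_mul, windowConst,
      inv_mul_cancel_left₀ (Complex.ofReal_ne_zero.2 h0)]
  rw [← hu, ← smul_eq_mul, ← map_smul, ← hGf]

theorem toTemperedDistributionCLM_comm (f g : 𝓢(V, ℂ)) :
    SchwartzMap.toTemperedDistributionCLM V ℂ volume f g =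
      SchwartzMap.toTemperedDistributionCLM V ℂ volume g f := by
  refine (SchwartzMap.toTemperedDistributionCLM_apply_apply volume f g).trans
    (Eq.trans ?_ (SchwartzMap.toTemperedDistributionCLM_apply_apply volume g f).symm)
  simp_rw [smul_eq_mul, mul_comm]

/-- Schwartz functions are sequentially dense in the tempered distributions. -/
theorem exists_seq_tendsto (u : 𝓢'(V, ℂ)) : ∃ f : ℕ → 𝓢(V, ℂ),
    Tendsto (fun n ↦ SchwartzMap.toTemperedDistributionCLM V ℂ volume (f n)) atTop (𝓝 u) := by
  obtain ⟨φ, hφ⟩ := exists_ne_zero (V := V)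
  have hcont := continuous_apply_conjugate_atom u φ
  obtain ⟨m, C, hC⟩ := polyGrowth_apply_conjugate_atom u φ
  -- Truncating the transform of `u` to balls gives coefficients of bounded support, from which
  -- Schwartz functions are synthesized.
  let S : ℕ → Set (V × V) := fun n ↦ Metric.closedBall 0 n
  let H : ℕ → V × V → ℂ := fun n ↦ (S n).indicator fun z ↦ u (conjugate (atom z φ))
  have hHm : ∀ n, AEStronglyMeasurable (H n) volume := fun n ↦
    hcont.aestronglyMeasurable.indicator Metric.isClosed_closedBall.measurableSet
  have hH : ∀ n, RapidDecay (H n) := by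
    intro n N
    refine ⟨(1 + n) ^ N * (|C| * (1 + n) ^ m), fun z ↦ ?_⟩
    by_cases hz : z ∈ S n
    · have hz' : ‖z‖ ≤ n := by simpa [S] using hz
      have h1 : ‖H n z‖ ≤ |C| * (1 + n) ^ m := by
        simp only [H, Set.indicator_of_mem hz]
        refine (hC z).trans ?_
        gcongr
        exact le_abs_self C
      gcongr
    · simp only [H, Set.indicator_of_notMem hz, norm_zero, mul_zero]
      positivity
  choose G hG using fun n ↦ exists_synthesis (hHm n) (hH n) φ
  refine ⟨fun n ↦ windowConst φ • G n, ?_⟩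
  rw [PointwiseConvergenceCLM.tendsto_iff_forall_tendsto]
  intro g
  have e : ∀ n, SchwartzMap.toTemperedDistributionCLM V ℂ volume (windowConst φ • G n) g =
      windowConst φ * ∫ z, H n z * windowCoeff φ g z := by
    intro n
    -- By symmetry of the pairing, `g` acts as the distribution on the synthesized function.
    rw [toTemperedDistributionCLM_comm, map_smul, hG, smul_eq_mul]
    simp_rw [toTemperedDistributionCLM_atom]
  simp_rw [e]
  rw [apply_eq_integral_windowCoeff hφ u g]
  refine Tendsto.const_mul _ ?_
  have hint : Integrable (fun z ↦ windowCoeff φ g z * u (conjugate (atom z φ))) :=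
    ((rapidDecay_windowCoeff φ g).mul_polyGrowth ⟨m, C, hC⟩).integrable volume
      ((continuous_windowCoeff φ g).mul hcont).aestronglyMeasurable
  refine tendsto_integral_of_dominated_convergence _
    (fun n ↦ (hHm n).mul (continuous_windowCoeff φ g).aestronglyMeasurable) hint.norm
    (fun n ↦ ae_of_all _ fun z ↦ ?_) (ae_of_all _ fun z ↦ ?_)
  · rw [norm_mul, norm_mul, mul_comm]
    gcongr
    exact norm_indicator_le_norm_self _ _
  · refine tendsto_const_nhds.congr' ?_
    obtain ⟨n₀, hn₀⟩ := exists_nat_ge ‖z‖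
    filter_upwards [eventually_ge_atTop n₀] with n hn
    have hz : z ∈ S n := by
      simpa [S] using hn₀.trans (by exact_mod_cast hn)
    simp only [H, Set.indicator_of_mem hz, mul_comm]

/-- Covariance: the substitution `t ↦ t + w.1` turns the time-frequency shift into a translation by
`w`, up to a factor of modulus one. -/
theorem norm_windowCoeff_conjugate_atom (φ ψ : 𝓢(V, ℂ)) (z w : V × V) :
    ‖windowCoeff φ (conjugate (atom w ψ)) z‖ = ‖windowCoeff φ (conjugate ψ) (z - w)‖ := by
  have h : windowCoeff φ (conjugate (atom w ψ)) z =
      Complex.exp (((inner ℝ w.1 (z.2 - w.2) : ℝ) : ℂ) * Complex.I) *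
        windowCoeff φ (conjugate ψ) (z - w) := by
    rw [windowCoeff, windowCoeff, ← integral_add_right_eq_self _ w.1, ← integral_const_mul]
    congr 1
    ext t
    simp only [conjugate_atom, atom_apply, conjugate_apply, Prod.fst_sub, Prod.snd_sub]
    have e : Complex.exp (((inner ℝ (t + w.1) (-w.2) : ℝ) : ℂ) * Complex.I) *
        Complex.exp (((inner ℝ (t + w.1) z.2 : ℝ) : ℂ) * Complex.I) =
        Complex.exp (((inner ℝ w.1 (z.2 - w.2) : ℝ) : ℂ) * Complex.I) *
        Complex.exp (((inner ℝ t (z.2 - w.2) : ℝ) : ℂ) * Complex.I) := by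
      rw [← Complex.exp_add, ← Complex.exp_add, ← add_mul, ← add_mul, ← Complex.ofReal_add,
        ← Complex.ofReal_add]
      congr 3
      simp only [inner_add_left, inner_sub_right, inner_neg_right]
      ring
    rw [add_sub_cancel_right, show t - (z.1 - w.1) = t + w.1 - z.1 by abel]
    linear_combination ((starRingEnd ℂ) (ψ t) * φ (t + w.1 - z.1)) * e
  rw [h, norm_mul, Complex.norm_exp_ofReal_mul_I, one_mul]

/-- Change of window: the short-time Fourier transforms with two windows are related by
convolution with a rapidly decaying function. -/
theorem norm_apply_conjugate_atom_le {φ : 𝓢(V, ℂ)} (hφ : φ ≠ 0) (ψ : 𝓢(V, ℂ)) (u : 𝓢'(V, ℂ))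
    (w : V × V) : ‖u (conjugate (atom w ψ))‖ ≤ ∫ z,
      ‖(windowConst φ * windowCoeff φ (conjugate ψ) (z - w))‖ * ‖u (conjugate (atom z φ))‖ := by
  rw [apply_eq_integral_windowCoeff hφ u, ← integral_const_mul]
  refine (norm_integral_le_integral_norm _).trans_eq ?_
  congr 1
  ext z
  rw [norm_mul, norm_mul, norm_windowCoeff_conjugate_atom, norm_mul, mul_assoc]

end Reproducing

/-! ### Anisotropic dilations and decay in cones. -/

section Dilation

variable {V : Type*} [NormedAddCommGroup V] [NormedSpace ℝ V]

/-- The anisotropic dilation `(x, ξ) ↦ (l x, l^s ξ)`. -/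
def dilation (s l : ℝ) (z : V × V) : V × V := (l • z.1, l ^ s • z.2)

theorem dilation_sub (s l : ℝ) (z w : V × V) :
    dilation s l z - dilation s l w = dilation s l (z - w) := by
  simp [dilation, smul_sub]

theorem dilation_dilation {s l m : ℝ} (hl : 0 ≤ l) (hm : 0 ≤ m) (z : V × V) :
    dilation s l (dilation s m z) = dilation s (l * m) z := by
  simp [dilation, smul_smul, Real.mul_rpow hl hm]

theorem dilation_one (s : ℝ) (z : V × V) : dilation s 1 z = z := by
  simp [dilation]

theorem dilation_dilation_inv {s l : ℝ} (hl : 0 < l) (z : V × V) :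
    dilation s l (dilation s l⁻¹ z) = z := by
  rw [dilation_dilation hl.le (inv_nonneg.2 hl.le), mul_inv_cancel₀ hl.ne', dilation_one]

theorem norm_dilation_le_of_le_one {s l : ℝ} (hs : 0 < s) (hl : 0 ≤ l) (hl1 : l ≤ 1) (z : V × V) :
    ‖dilation s l z‖ ≤ ‖z‖ := by
  have h2 : l ^ s ≤ 1 := Real.rpow_le_one hl hl1 hs.le
  rw [dilation, Prod.norm_mk, norm_smul, norm_smul, Real.norm_of_nonneg hl,
    Real.norm_of_nonneg (Real.rpow_nonneg hl s)]
  exact max_le ((mul_le_of_le_one_left (norm_nonneg _) hl1).trans (norm_fst_le z))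
    ((mul_le_of_le_one_left (norm_nonneg _) h2).trans (norm_snd_le z))

/-- A natural exponent that controls dilations from above. -/
theorem exists_norm_dilation_le (s : ℝ) :
    ∃ a : ℕ, ∀ (l : ℝ) (z : V × V), 1 ≤ l → ‖dilation s l z‖ ≤ l ^ a * ‖z‖ := by
  obtain ⟨a, ha⟩ := exists_nat_ge s
  refine ⟨a + 1, fun l z hl ↦ ?_⟩
  have hl0 : 0 ≤ l := zero_le_one.trans hl
  have h1 : l ≤ l ^ (a + 1) := le_self_pow₀ hl (by simp)
  have h2 : l ^ s ≤ l ^ (a + 1) := by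
    rw [← Real.rpow_natCast]
    exact Real.rpow_le_rpow_of_exponent_le hl (ha.trans (by simp))
  rw [dilation, Prod.norm_mk, norm_smul, norm_smul, Real.norm_of_nonneg hl0,
    Real.norm_of_nonneg (Real.rpow_nonneg hl0 s)]
  have := norm_fst_le z
  have := norm_snd_le z
  exact max_le (by gcongr) (by gcongr)

/-- A natural exponent that controls dilations from below. -/
theorem exists_mul_pow_le_norm_dilation {s : ℝ} (hs : 0 < s) :
    ∃ b : ℕ, ∀ (l : ℝ) (z : V × V), 1 ≤ l → l * ‖z‖ ^ b ≤ ‖dilation s l z‖ ^ b := by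
  -- With `b ≥ 1 / s` the power `(l ^ s) ^ b` is at least `l`; the increment to `b + 1` keeps the
  -- exponent positive, as the first component needs.
  obtain ⟨b, hb⟩ := exists_nat_ge s⁻¹
  refine ⟨b + 1, fun l z hl ↦ ?_⟩
  have hl0 : 0 ≤ l := zero_le_one.trans hl
  have h1 : l ≤ l ^ (b + 1) := le_self_pow₀ hl (by simp)
  have h2 : l ≤ (l ^ s) ^ (b + 1) := by
    rw [← Real.rpow_natCast, ← Real.rpow_mul hl0]
    nth_rewrite 1 [← Real.rpow_one l]
    refine Real.rpow_le_rpow_of_exponent_le hl ?_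
    have : 1 ≤ s * b := by
      calc (1 : ℝ) = s * s⁻¹ := (mul_inv_cancel₀ hs.ne').symm
        _ ≤ s * b := by gcongr
    push_cast
    nlinarith
  have hd1 : ‖l • z.1‖ ≤ ‖dilation s l z‖ := norm_fst_le (dilation s l z)
  have hd2 : ‖l ^ s • z.2‖ ≤ ‖dilation s l z‖ := norm_snd_le (dilation s l z)
  rw [norm_smul, Real.norm_of_nonneg hl0] at hd1
  rw [norm_smul, Real.norm_of_nonneg (Real.rpow_nonneg hl0 s)] at hd2
  rcases max_choice ‖z.1‖ ‖z.2‖ with h | h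
  · rw [Prod.norm_def, h]
    calc _ ≤ l ^ (b + 1) * ‖z.1‖ ^ (b + 1) := by gcongr
      _ = (l * ‖z.1‖) ^ (b + 1) := (mul_pow _ _ _).symm
      _ ≤ _ := by gcongr
  · rw [Prod.norm_def, h]
    calc _ ≤ (l ^ s) ^ (b + 1) * ‖z.2‖ ^ (b + 1) := by gcongr
      _ = (l ^ s * ‖z.2‖) ^ (b + 1) := (mul_pow _ _ _).symm
      _ ≤ _ := by gcongr

/-- Rapid decay of `F` in an anisotropic cone around `z₀`. -/
def ConeDecay (s : ℝ) (F : V × V → ℂ) (z₀ : V × V) : Prop :=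
  ∃ U ∈ 𝓝 z₀, ∀ N : ℕ, ∃ C : ℝ, ∀ z ∈ U, ∀ l : ℝ, 1 ≤ l → l ^ N * ‖F (dilation s l z)‖ ≤ C

theorem one_add_norm_le_mul {X : Type*} [SeminormedAddCommGroup X] (z w : X) :
    1 + ‖z‖ ≤ (1 + ‖w‖) * (1 + ‖z - w‖) := by
  have : ‖z‖ ≤ ‖z - w‖ + ‖w‖ := by simpa using norm_add_le (z - w) w
  nlinarith [mul_nonneg (norm_nonneg w) (norm_nonneg (z - w))]

variable [FiniteDimensional ℝ V] [MeasurableSpace V] [BorelSpace V]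

/-- Cone decay is stable under convolution with rapidly decaying functions. -/
theorem ConeDecay.of_le_convolution {s : ℝ} (hs : 0 < s) (μ : Measure (V × V))
    [μ.IsAddHaarMeasure] {F G Θ : V × V → ℂ}
    (hF : PolyGrowth F) (hΘ : RapidDecay Θ) (hG : ∀ w, ‖G w‖ ≤ ∫ z, ‖Θ (z - w)‖ * ‖F z‖ ∂μ)
    {z₀ : V × V} (h : ConeDecay s F z₀) : ConeDecay s G z₀ := by
  obtain ⟨U, hU, hdec⟩ := h
  obtain ⟨ε, hε, hεU⟩ := Metric.mem_nhds_iff.1 hU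
  obtain ⟨m, B, hB⟩ := hF
  obtain ⟨a, ha⟩ := exists_norm_dilation_le (V := V) s
  obtain ⟨b, hb⟩ := exists_mul_pow_le_norm_dilation (V := V) hs
  refine ⟨Metric.ball z₀ (ε / 2), Metric.ball_mem_nhds _ (by positivity), fun N ↦ ?_⟩
  set D := Module.finrank ℝ (V × V) + 1
  set M := a * m + N with hM
  obtain ⟨C₁, hC₁⟩ := hdec N
  obtain ⟨C₂, hC₂⟩ := hΘ D
  obtain ⟨C₃, hC₃⟩ := hΘ (D + b * M + m)
  set R := 1 + ‖z₀‖ + ε with hR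
  have hR0 : 0 < R := by positivity
  -- One summand for each case below: the dilated-back point `z'` inside the cone neighbourhood, or
  -- away from `w`.
  set A := |C₂| * |C₁| + |B| * R ^ m * ((ε / 2) ^ b)⁻¹ ^ M * |C₃| with hA
  have hDint := integrable_inv_one_add_norm_pow μ (X := V × V) (D := D) (Nat.lt_succ_self _)
  refine ⟨A * ∫ z, ((1 + ‖z‖) ^ D)⁻¹ ∂μ, fun w hw l hl ↦ ?_⟩
  have hl0 : 0 < l := zero_lt_one.trans_le hl
  set W := dilation s l w with hW
  have hwR : 1 + ‖w‖ ≤ R := by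
    have h1 : ‖w - z₀‖ < ε / 2 := by simpa [dist_eq_norm] using hw
    have h2 : ‖w‖ ≤ ‖w - z₀‖ + ‖z₀‖ := by simpa using norm_add_le (w - z₀) z₀
    linarith
  have hWR : 1 + ‖W‖ ≤ l ^ a * R := by
    have h1 : 1 ≤ l ^ a := one_le_pow₀ hl
    calc 1 + ‖W‖ ≤ l ^ a + l ^ a * ‖w‖ := add_le_add h1 (ha l w hl)
      _ = l ^ a * (1 + ‖w‖) := by ring
      _ ≤ l ^ a * R := by gcongr
  have key : ∀ z, l ^ N * (‖Θ (z - W)‖ * ‖F z‖) ≤ A * ((1 + ‖z - W‖) ^ D)⁻¹ := by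
    intro z
    set t := 1 + ‖z - W‖ with ht
    have ht0 : 0 < t := by positivity
    rw [← div_eq_mul_inv, le_div_iff₀ (by positivity)]
    have hz := dilation_dilation_inv (s := s) hl0 z
    set z' := dilation s l⁻¹ z
    by_cases hzU : z' ∈ Metric.ball z₀ ε
    · have h1 : l ^ N * ‖F z‖ ≤ |C₁| := by
        rw [← hz]; exact (hC₁ z' (hεU hzU) l hl).trans (le_abs_self _)
      have h2 : t ^ D * ‖Θ (z - W)‖ ≤ |C₂| := (hC₂ _).trans (le_abs_self _)
      calc _ = (t ^ D * ‖Θ (z - W)‖) * (l ^ N * ‖F z‖) := by ring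
        _ ≤ |C₂| * |C₁| := by gcongr
        _ ≤ A := le_add_of_nonneg_right (by positivity)
    · have hdist : ε / 2 ≤ ‖z' - w‖ := by
        have h1 : ‖w - z₀‖ < ε / 2 := by simpa [dist_eq_norm] using hw
        have h2 : ε ≤ ‖z' - z₀‖ := by simpa [dist_eq_norm] using hzU
        have h3 : ‖z' - z₀‖ ≤ ‖z' - w‖ + ‖w - z₀‖ := by simpa using norm_add_le (z' - w) (w - z₀)
        linarith
      -- Points at distance at least `ε / 2` separate under dilation, so powers of `l` are bounded
      -- by powers of `t`, which the decay of `Θ` absorbs.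
      have hlt : l ≤ ((ε / 2) ^ b)⁻¹ * t ^ b := by
        have h1 := hb l (z' - w) hl
        rw [← dilation_sub, hz, ← hW] at h1
        rw [← div_eq_inv_mul, le_div_iff₀ (by positivity)]
        calc l * (ε / 2) ^ b ≤ l * ‖z' - w‖ ^ b := by gcongr
          _ ≤ ‖z - W‖ ^ b := h1
          _ ≤ t ^ b := by gcongr; linarith
      have hFz : ‖F z‖ ≤ |B| * ((l ^ a * R) * t) ^ m := by
        refine (hB z).trans ?_
        refine mul_le_mul (le_abs_self B) ?_ (by positivity) (abs_nonneg B)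
        refine pow_le_pow_left₀ (by positivity) ((one_add_norm_le_mul z W).trans ?_) m
        gcongr
      have h3 : t ^ (D + b * M + m) * ‖Θ (z - W)‖ ≤ |C₃| := (hC₃ _).trans (le_abs_self _)
      calc l ^ N * (‖Θ (z - W)‖ * ‖F z‖) * t ^ D
          ≤ l ^ N * (‖Θ (z - W)‖ * (|B| * ((l ^ a * R) * t) ^ m)) * t ^ D := by gcongr
        _ = |B| * R ^ m * l ^ M * (t ^ (D + m) * ‖Θ (z - W)‖) := by
          rw [hM, mul_pow, mul_pow, pow_add, pow_add, pow_mul]; ring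
        _ ≤ |B| * R ^ m * (((ε / 2) ^ b)⁻¹ * t ^ b) ^ M * (t ^ (D + m) * ‖Θ (z - W)‖) := by
          gcongr
        _ = |B| * R ^ m * ((ε / 2) ^ b)⁻¹ ^ M * (t ^ (D + b * M + m) * ‖Θ (z - W)‖) := by
          rw [mul_pow, ← pow_mul, pow_add, pow_add, pow_add]; ring
        _ ≤ |B| * R ^ m * ((ε / 2) ^ b)⁻¹ ^ M * |C₃| := by gcongr
        _ ≤ A := le_add_of_nonneg_left (by positivity)
  calc l ^ N * ‖G W‖ ≤ l ^ N * ∫ z, ‖Θ (z - W)‖ * ‖F z‖ ∂μ := by gcongr; exact hG W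
    _ = ∫ z, l ^ N * (‖Θ (z - W)‖ * ‖F z‖) ∂μ := (integral_const_mul _ _).symm
    _ ≤ ∫ z, A * ((1 + ‖z - W‖) ^ D)⁻¹ ∂μ :=
      integral_mono_of_nonneg (ae_of_all _ fun z ↦ by positivity)
        ((hDint.comp_sub_right W).const_mul A) (ae_of_all _ key)
    _ = A * ∫ z, ((1 + ‖z‖) ^ D)⁻¹ ∂μ := by
      rw [integral_const_mul, integral_sub_right_eq_self (fun z ↦ ((1 + ‖z‖) ^ D)⁻¹) W]

end Dilation

/-! ### The wave front set as failure of cone decay, and its independence of the window. -/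

section Wavefront

theorem norm_stft {V : Type*} [NormedAddCommGroup V] [InnerProductSpace ℝ V] (φ : 𝓢(V, ℂ))
    (u : 𝓢'(V, ℂ)) (s l : ℝ) (z : V × V) :
    ‖stft φ u (l • z.1) (l ^ s • z.2)‖ = (2 * Real.pi) ^ (-(Module.finrank ℝ V : ℝ) / 2) *
      ‖u (conjugate (atom (dilation s l z) φ))‖ := by
  rw [stft, norm_mul, Complex.norm_real, Real.norm_of_nonneg (by positivity)]
  rfl

variable {V : Type*} [NormedAddCommGroup V] [InnerProductSpace ℝ V] [FiniteDimensional ℝ V]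
  [MeasurableSpace V] [BorelSpace V]

theorem ConeDecay.change_window {s : ℝ} (hs : 0 < s) {φ : 𝓢(V, ℂ)} (hφ : φ ≠ 0) (ψ : 𝓢(V, ℂ))
    {u : 𝓢'(V, ℂ)} {z₀ : V × V} (h : ConeDecay s (fun z ↦ u (conjugate (atom z φ))) z₀) :
    ConeDecay s (fun z ↦ u (conjugate (atom z ψ))) z₀ := by
  have hΘ : RapidDecay fun z ↦ windowConst φ * windowCoeff φ (conjugate ψ) z := by
    have := (rapidDecay_windowCoeff φ (conjugate ψ)).mul_polyGrowth (G := fun _ ↦ windowConst φ)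
      ⟨0, ‖windowConst φ‖, fun z ↦ by simp⟩
    simpa only [mul_comm] using this
  exact h.of_le_convolution hs volume (polyGrowth_apply_conjugate_atom u φ) hΘ
    (norm_apply_conjugate_atom_le hφ ψ u)

/-- Parameters `l ≤ 1` impose no condition: there the dilations of a bounded set stay bounded, and
polynomial growth suffices. -/
theorem mem_wavefront_iff {s : ℝ} (hs : 0 < s) (φ : 𝓢(V, ℂ)) (u : 𝓢'(V, ℂ)) (z₀ : V × V) :
    z₀ ∈ wavefront s φ u ↔
      z₀ ≠ 0 ∧ ¬ ConeDecay s (fun z ↦ u (conjugate (atom z φ))) z₀ := by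
  have hk : 0 < (2 * Real.pi) ^ (-(Module.finrank ℝ V : ℝ) / 2) := by positivity
  simp only [wavefront, Set.mem_ofPred_eq, norm_stft]
  set k := (2 * Real.pi) ^ (-(Module.finrank ℝ V : ℝ) / 2)
  refine and_congr_right fun _ ↦ not_congr ⟨?_, ?_⟩
  · rintro ⟨U, hU, hz, h⟩
    refine ⟨U, hU.mem_nhds hz, fun N ↦ ?_⟩
    obtain ⟨C, hC⟩ := h N
    refine ⟨k⁻¹ * C, fun z hz l hl ↦ ?_⟩
    rw [← div_eq_inv_mul, le_div_iff₀ hk]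
    calc _ = l ^ N * (k * ‖u (conjugate (atom (dilation s l z) φ))‖) := by ring
      _ ≤ C := hC z hz l (zero_lt_one.trans_le hl)
  · rintro ⟨U, hU, h⟩
    obtain ⟨m, B, hB⟩ := polyGrowth_apply_conjugate_atom u φ
    obtain ⟨ε, hε, hεU⟩ := Metric.mem_nhds_iff.1 hU
    refine ⟨Metric.ball z₀ ε, Metric.isOpen_ball, Metric.mem_ball_self hε, fun N ↦ ?_⟩
    obtain ⟨C, hC⟩ := h N
    refine ⟨k * max C (|B| * (1 + (‖z₀‖ + ε)) ^ m), fun z hz l hl ↦ ?_⟩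
    rw [mul_left_comm]
    refine mul_le_mul_of_nonneg_left ?_ hk.le
    rcases le_total 1 l with h1 | h1
    · exact (hC z (hεU hz) l h1).trans (le_max_left _ _)
    · refine le_trans ?_ (le_max_right _ _)
      have h2 : ‖z‖ ≤ ‖z₀‖ + ε := by
        have h3 : ‖z - z₀‖ < ε := by simpa [dist_eq_norm] using hz
        have h4 : ‖z‖ ≤ ‖z - z₀‖ + ‖z₀‖ := by simpa using norm_add_le (z - z₀) z₀
        linarith
      refine (mul_le_of_le_one_left (norm_nonneg _) (pow_le_one₀ hl.le h1)).trans ?_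
      refine (hB _).trans ?_
      have := (norm_dilation_le_of_le_one hs hl.le h1 z).trans h2
      gcongr
      exact le_abs_self B

/-- The wave front set does not depend on the window. -/
theorem wavefront_eq {s : ℝ} (hs : 0 < s) {φ ψ : 𝓢(V, ℂ)} (hφ : φ ≠ 0) (hψ : ψ ≠ 0)
    (u : 𝓢'(V, ℂ)) : wavefront s φ u = wavefront s ψ u := by
  ext z
  rw [mem_wavefront_iff hs, mem_wavefront_iff hs]
  exact and_congr_right fun _ ↦ not_congr
    ⟨fun h ↦ h.change_window hs hφ ψ, fun h ↦ h.change_window hs hψ φ⟩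

end Wavefront

/-! ### Decay of kernels in two phase space variables. -/

section PairDecay

variable {V : Type*} [NormedAddCommGroup V] [NormedSpace ℝ V]

/-- Uniform rapid decay of `F` along the dilations of `U × S`. -/
def PairDecayOn (s : ℝ) (F : V × V → V × V → ℂ) (U S : Set (V × V)) : Prop :=
  ∀ N : ℕ, ∃ C : ℝ, ∀ z ∈ U, ∀ w ∈ S, ∀ l : ℝ, 1 ≤ l →
    l ^ N * ‖F (dilation s l z) (dilation s l w)‖ ≤ C

/-- Growth at most like a power in both variables. -/
def PairGrowth (F : V × V → V × V → ℂ) : Prop :=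
  ∃ (m : ℕ) (C : ℝ), ∀ z w, ‖F z w‖ ≤ C * ((1 + ‖z‖) ^ m * (1 + ‖w‖) ^ m)

theorem PairDecayOn.mono {s : ℝ} {F : V × V → V × V → ℂ} {U U' S S' : Set (V × V)}
    (h : PairDecayOn s F U S) (hU : U' ⊆ U) (hS : S' ⊆ S) : PairDecayOn s F U' S' := fun N ↦
  let ⟨C, hC⟩ := h N
  ⟨C, fun z hz w hw ↦ hC z (hU hz) w (hS hw)⟩

theorem PairDecayOn.union {s : ℝ} {F : V × V → V × V → ℂ} {U S S' : Set (V × V)}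
    (h : PairDecayOn s F U S) (h' : PairDecayOn s F U S') : PairDecayOn s F U (S ∪ S') := by
  intro N
  obtain ⟨C, hC⟩ := h N
  obtain ⟨C', hC'⟩ := h' N
  refine ⟨max C C', fun z hz w hw l hl ↦ ?_⟩
  rcases hw with hw | hw
  · exact (hC z hz w hw l hl).trans (le_max_left _ _)
  · exact (hC' z hz w hw l hl).trans (le_max_right _ _)

theorem exists_pairDecayOn_of_isCompact {s : ℝ} {F : V × V → V × V → ℂ} {z₀ : V × V}
    {S : Set (V × V)} (hS : IsCompact S)
    (h : ∀ w ∈ S, ∃ U ∈ 𝓝 z₀, ∃ W ∈ 𝓝 w, PairDecayOn s F U W) :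
    ∃ U ∈ 𝓝 z₀, PairDecayOn s F U S := by
  refine hS.induction_on (p := fun S ↦ ∃ U ∈ 𝓝 z₀, PairDecayOn s F U S) ?_ ?_ ?_ ?_
  · exact ⟨Set.univ, univ_mem, fun N ↦ ⟨0, by simp⟩⟩
  · rintro S T hST ⟨U, hU, hd⟩
    exact ⟨U, hU, hd.mono le_rfl hST⟩
  · rintro S T ⟨U, hU, hd⟩ ⟨U', hU', hd'⟩
    exact ⟨U ∩ U', inter_mem hU hU', (hd.mono Set.inter_subset_left le_rfl).union
      (hd'.mono Set.inter_subset_right le_rfl)⟩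
  · intro w hw
    obtain ⟨U, hU, W, hW, hd⟩ := h w hw
    exact ⟨W, mem_nhdsWithin_of_mem_nhds hW, U, hU, hd⟩

theorem one_add_norm_dilation_le {s l R : ℝ} {a : ℕ} {z : V × V} (hl : 1 ≤ l)
    (ha : ∀ (l : ℝ) (z : V × V), 1 ≤ l → ‖dilation s l z‖ ≤ l ^ a * ‖z‖) (hz : ‖z‖ ≤ R) :
    1 + ‖dilation s l z‖ ≤ l ^ a * (1 + R) := by
  have h1 : 1 ≤ l ^ a := one_le_pow₀ hl
  have h2 : l ^ a * ‖z‖ ≤ l ^ a * R := by gcongr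
  linarith [ha l z hl]

theorem PairDecayOn.mul_pairGrowth {s : ℝ} {F G : V × V → V × V → ℂ} {U S : Set (V × V)}
    (h : PairDecayOn s F U S) (hG : PairGrowth G) (hU : Bornology.IsBounded U)
    (hS : Bornology.IsBounded S) : PairDecayOn s (fun z w ↦ F z w * G z w) U S := by
  obtain ⟨a, ha⟩ := exists_norm_dilation_le (V := V) s
  obtain ⟨m, B, hB⟩ := hG
  obtain ⟨R, hR⟩ := (hU.union hS).exists_norm_le
  intro N
  obtain ⟨C, hC⟩ := h (N + a * m + a * m)
  refine ⟨|C| * (|B| * ((1 + R) ^ m * (1 + R) ^ m)), fun z hz w hw l hl ↦ ?_⟩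
  have hl0 : 0 < l := zero_lt_one.trans_le hl
  have hz' := one_add_norm_dilation_le hl ha (hR z (Or.inl hz))
  have hw' := one_add_norm_dilation_le hl ha (hR w (Or.inr hw))
  have hR0 : 0 ≤ R := (norm_nonneg z).trans (hR z (Or.inl hz))
  set Z := dilation s l z
  set W := dilation s l w
  have h1 : ‖G Z W‖ ≤ |B| * ((l ^ a * (1 + R)) ^ m * (l ^ a * (1 + R)) ^ m) := by
    refine (hB Z W).trans ?_
    gcongr
    exact le_abs_self B
  calc l ^ N * ‖F Z W * G Z W‖
      ≤ l ^ N * (‖F Z W‖ * (|B| * ((l ^ a * (1 + R)) ^ m * (l ^ a * (1 + R)) ^ m))) := by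
        rw [norm_mul]; gcongr
    _ = (l ^ (N + a * m + a * m) * ‖F Z W‖) * (|B| * ((1 + R) ^ m * (1 + R) ^ m)) := by
        rw [pow_add, pow_add, pow_mul, mul_pow]; ring
    _ ≤ _ := by
        gcongr
        exact (hC z hz w hw l hl).trans (le_abs_self C)

/-- Every vector outside the unit ball is a dilation of a unit vector. -/
theorem exists_eq_dilation {s : ℝ} (hs : 0 < s) {w : V × V} (hw : 1 ≤ ‖w‖) :
    ∃ (l : ℝ) (w₁ : V × V), 1 ≤ l ∧ ‖w₁‖ = 1 ∧ w = dilation s l w₁ := by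
  have hc : ContinuousOn (fun t : ℝ ↦ ‖dilation s t w‖) (Set.Icc 0 1) := by
    have : Continuous fun t : ℝ ↦ t ^ s := Real.continuous_rpow_const hs.le
    unfold dilation
    exact Continuous.continuousOn (by fun_prop)
  -- The norm of `dilation s t w` runs from `0` at `t = 0` to `‖w‖ ≥ 1` at `t = 1`, so it takes the
  -- value `1`.
  have h0 : ‖dilation s 0 w‖ = 0 := by simp [dilation, Real.zero_rpow hs.ne']
  obtain ⟨t, ⟨ht0, ht1⟩, ht⟩ := intermediate_value_Icc zero_le_one hc
    (show (1 : ℝ) ∈ Set.Icc _ _ by rw [dilation_one, h0]; exact ⟨zero_le_one, hw⟩)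
  have htpos : 0 < t := ht0.lt_of_ne (by rintro rfl; simp [h0] at ht)
  refine ⟨t⁻¹, dilation s t w, (one_le_inv₀ htpos).2 ht1, ht, ?_⟩
  rw [dilation_dilation (inv_nonneg.2 ht0) ht0, inv_mul_cancel₀ htpos.ne', dilation_one]

/-- If a kernel of polynomial growth decays near the axis `{0} × S`, with `S` the unit sphere,
then it decays in the second variable at the price of growth in the first one. -/
theorem exists_decay_snd {s : ℝ} (hs : 0 < s) {F : V × V → V × V → ℂ} (hF : PairGrowth F)
    {U : Set (V × V)} (hU : U ∈ 𝓝 0) (h : PairDecayOn s F U (Metric.sphere 0 1)) (N : ℕ) :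
    ∃ (M : ℕ) (C : ℝ), ∀ z w, (1 + ‖w‖) ^ N * ‖F z w‖ ≤ C * (1 + ‖z‖) ^ M := by
  obtain ⟨ε, hε, hεU⟩ := Metric.mem_nhds_iff.1 hU
  obtain ⟨a, ha⟩ := exists_norm_dilation_le (V := V) s
  obtain ⟨b, hb⟩ := exists_mul_pow_le_norm_dilation (V := V) hs
  obtain ⟨m, B, hB⟩ := hF
  obtain ⟨C, hC⟩ := h (a * N)
  set c := (1 + (ε ^ b)⁻¹) with hc
  have hc1 : 1 ≤ c := le_add_of_nonneg_right (by positivity)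
  refine ⟨m + b * a * (m + N), 2 ^ N * |C| + |B| * (2 * c ^ a) ^ (m + N), fun z w ↦ ?_⟩
  have hz1 : 1 ≤ 1 + ‖z‖ := le_add_of_nonneg_right (norm_nonneg z)
  -- If `w` is bounded by a power of `1 + ‖z‖`, polynomial growth suffices. Otherwise dilating `w`
  -- to the unit sphere brings `z` into the ball of radius `ε`, where the assumed decay applies.
  by_cases hgood : 1 + ‖w‖ ≤ 2 * c ^ a * (1 + ‖z‖) ^ (b * a)
  · calc (1 + ‖w‖) ^ N * ‖F z w‖
        ≤ (1 + ‖w‖) ^ N * (|B| * ((1 + ‖z‖) ^ m * (1 + ‖w‖) ^ m)) := by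
          gcongr
          refine (hB z w).trans ?_
          gcongr
          exact le_abs_self B
      _ = |B| * (1 + ‖z‖) ^ m * (1 + ‖w‖) ^ (m + N) := by rw [pow_add]; ring
      _ ≤ |B| * (1 + ‖z‖) ^ m * (2 * c ^ a * (1 + ‖z‖) ^ (b * a)) ^ (m + N) := by gcongr
      _ = |B| * (2 * c ^ a) ^ (m + N) * (1 + ‖z‖) ^ (m + b * a * (m + N)) := by
          rw [mul_pow _ ((1 + ‖z‖) ^ (b * a)), ← pow_mul, pow_add (1 + ‖z‖)]; ring
      _ ≤ _ := by
          gcongr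
          exact le_add_of_nonneg_left (by positivity)
  · have hw1 : 1 ≤ ‖w‖ := by
      by_contra hlt
      apply hgood
      have h1 : 1 ≤ c ^ a * (1 + ‖z‖) ^ (b * a) :=
        one_le_mul_of_one_le_of_one_le (one_le_pow₀ hc1) (one_le_pow₀ hz1)
      rw [mul_assoc]
      linarith
    obtain ⟨l, w₁, hl, hw₁, rfl⟩ := exists_eq_dilation hs hw1
    have hl0 : 0 < l := zero_lt_one.trans_le hl
    have hwl : 1 + ‖dilation s l w₁‖ ≤ 2 * l ^ a := by
      have := ha l w₁ hl
      rw [hw₁, mul_one] at this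
      linarith
    have hz := dilation_dilation_inv (s := s) hl0 z
    set z₁ := dilation s l⁻¹ z
    have hz₁ : z₁ ∈ Metric.ball 0 ε := by
      by_contra hfar
      apply hgood
      have hfar' : ε ≤ ‖z₁‖ := by simpa using hfar
      have h1 : l ≤ c * (1 + ‖z‖) ^ b := by
        have h2 := hb l z₁ hl
        rw [hz] at h2
        have h3 : l ≤ (ε ^ b)⁻¹ * (1 + ‖z‖) ^ b := by
          rw [← div_eq_inv_mul, le_div_iff₀ (by positivity)]
          calc l * ε ^ b ≤ l * ‖z₁‖ ^ b := by gcongr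
            _ ≤ ‖z‖ ^ b := h2
            _ ≤ (1 + ‖z‖) ^ b := by gcongr; linarith
        refine h3.trans ?_
        gcongr
        linarith
      calc 1 + ‖dilation s l w₁‖ ≤ 2 * l ^ a := hwl
        _ ≤ 2 * (c * (1 + ‖z‖) ^ b) ^ a := by gcongr
        _ = 2 * c ^ a * (1 + ‖z‖) ^ (b * a) := by rw [mul_pow, pow_mul]; ring
    have h4 := hC z₁ (hεU hz₁) w₁ (by simpa using hw₁) l hl
    rw [hz] at h4
    calc (1 + ‖dilation s l w₁‖) ^ N * ‖F z (dilation s l w₁)‖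
        ≤ (2 * l ^ a) ^ N * ‖F z (dilation s l w₁)‖ := by gcongr
      _ = 2 ^ N * (l ^ (a * N) * ‖F z (dilation s l w₁)‖) := by rw [mul_pow, ← pow_mul]; ring
      _ ≤ 2 ^ N * |C| := by gcongr; exact h4.trans (le_abs_self C)
      _ ≤ (2 ^ N * |C| + |B| * (2 * c ^ a) ^ (m + N)) * 1 := by
          rw [mul_one]; exact le_add_of_nonneg_right (by positivity)
      _ ≤ _ := by
          gcongr
          exact one_le_pow₀ hz1

/-- If `F` decays near `{0} × S`, with `S` the unit sphere, then it decays for bounded first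
variable and large second variable. -/
theorem exists_decay_of_large_snd {s : ℝ} (hs : 0 < s) {F : V × V → V × V → ℂ}
    {U : Set (V × V)} (hU : U ∈ 𝓝 0) (h : PairDecayOn s F U (Metric.sphere 0 1)) (R₀ : ℝ) :
    ∃ R : ℝ, 1 ≤ R ∧ ∀ N D : ℕ, ∃ C : ℝ, ∀ z w, ‖z‖ ≤ R₀ → R ≤ ‖w‖ → ∀ l : ℝ, 1 ≤ l →
      l ^ N * (1 + ‖dilation s l w‖) ^ D * ‖F (dilation s l z) (dilation s l w)‖ ≤ C := by
  obtain ⟨ε, hε, hεU⟩ := Metric.mem_nhds_iff.1 hU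
  obtain ⟨a, ha⟩ := exists_norm_dilation_le (V := V) s
  obtain ⟨b, hb⟩ := exists_mul_pow_le_norm_dilation (V := V) hs
  -- Chosen so that `T * ε ^ b > |R₀| ^ b`: dilating back by `t ≥ T` moves the ball of radius `R₀`
  -- into the ball of radius `ε`. The radius `T ^ a + 1` for `w` forces `t ≥ T`.
  set T := 1 + (|R₀| ^ b + 1) / ε ^ b with hT
  have hT1 : 1 ≤ T := le_add_of_nonneg_right (by positivity)
  refine ⟨T ^ a + 1, le_add_of_nonneg_left (by positivity), fun N D ↦ ?_⟩
  obtain ⟨C, hC⟩ := h (N + a * D)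
  refine ⟨2 ^ D * |C|, fun z w hz hw l hl ↦ ?_⟩
  have hl0 : 0 < l := zero_lt_one.trans_le hl
  obtain ⟨t, w₁, ht, hw₁, rfl⟩ := exists_eq_dilation hs
    ((le_add_of_nonneg_left (by positivity : (0 : ℝ) ≤ T ^ a)).trans hw)
  have ht0 : 0 < t := zero_lt_one.trans_le ht
  have htT : T ≤ t := by
    by_contra! hlt
    have h1 := ha t w₁ ht
    rw [hw₁, mul_one] at h1
    have h2 : t ^ a ≤ T ^ a := by gcongr
    linarith
  have hzt := dilation_dilation_inv (s := s) ht0 z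
  set z₁ := dilation s t⁻¹ z
  have hz₁ : z₁ ∈ Metric.ball 0 ε := by
    by_contra hfar
    have hfar' : ε ≤ ‖z₁‖ := by simpa using hfar
    have h1 := hb t z₁ ht
    rw [hzt] at h1
    have h2 : T * ε ^ b ≤ |R₀| ^ b := by
      calc T * ε ^ b ≤ t * ‖z₁‖ ^ b := by gcongr
        _ ≤ ‖z‖ ^ b := h1
        _ ≤ |R₀| ^ b := by gcongr; exact hz.trans (le_abs_self R₀)
    rw [hT, add_mul, div_mul_cancel₀ _ (by positivity)] at h2
    have : 0 < ε ^ b := by positivity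
    linarith
  -- The two dilations merge into one with parameter `l * t`, which controls both `l` and the size
  -- of the dilated `w`.
  have hlt : 1 ≤ l * t := one_le_mul_of_one_le_of_one_le hl ht
  have h4 := hC z₁ (hεU hz₁) w₁ (by simpa using hw₁) (l * t) hlt
  rw [← dilation_dilation hl0.le ht0.le, ← dilation_dilation hl0.le ht0.le, hzt] at h4
  have hW : 1 + ‖dilation s l (dilation s t w₁)‖ ≤ 2 * (l * t) ^ a := by
    rw [dilation_dilation hl0.le ht0.le]
    have h1 := ha (l * t) w₁ hlt
    have h2 : 1 ≤ (l * t) ^ a := one_le_pow₀ hlt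
    rw [hw₁, mul_one] at h1
    linarith
  set W := dilation s l (dilation s t w₁)
  calc l ^ N * (1 + ‖W‖) ^ D * ‖F (dilation s l z) W‖
      ≤ (l * t) ^ N * (2 * (l * t) ^ a) ^ D * ‖F (dilation s l z) W‖ := by
        gcongr
        exact le_mul_of_one_le_right hl0.le ht
    _ = 2 ^ D * ((l * t) ^ (N + a * D) * ‖F (dilation s l z) W‖) := by
        rw [mul_pow 2, ← pow_mul, pow_add]; ring
    _ ≤ _ := by gcongr; exact h4.trans (le_abs_self C)

end PairDecay

/-! ### The kernel operator, its extension and its wave front set. -/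

section Kernel

variable {d : ℕ}

theorem tensor_conjugate_atom (χ : 𝓢(Rd d, ℂ)) (z w : Rd d × Rd d) :
    tensor (conjugate (atom z χ)) (conjugate (atom w χ)) =
      conjugate (atom (phasePoint z.1 w.1 z.2 w.2) (tensor χ χ)) := by
  ext t
  simp only [tensor_apply, conjugate_apply, atom_apply, phasePoint, ← map_mul]
  congr 1
  simp only [WithLp.prod_inner_apply, WithLp.sub_fst, WithLp.sub_snd, Complex.ofReal_add, add_mul,
    Complex.exp_add]
  change _ = Complex.exp (((inner ℝ t.fst z.2 : ℝ) : ℂ) * Complex.I) *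
    Complex.exp (((inner ℝ t.snd w.2 : ℝ) : ℂ) * Complex.I) *
      (χ (t.fst - z.1) * χ (t.snd - w.1))
  ring

/-- The short-time Fourier transform of the kernel with respect to a tensor window, without its
normalizing constant. -/
def kernelCoeff (K : 𝓢'(R2d d, ℂ)) (χ : 𝓢(Rd d, ℂ)) (z w : Rd d × Rd d) : ℂ :=
  K (tensor (conjugate (atom z χ)) (conjugate (atom w χ)))

theorem continuous_phasePoint :
    Continuous fun p : (Rd d × Rd d) × (Rd d × Rd d) ↦
      phasePoint p.1.1 p.2.1 p.1.2 p.2.2 := by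
  unfold phasePoint
  exact ((WithLp.prod_continuous_toLp 2 _ _).comp (by fun_prop)).prodMk
    ((WithLp.prod_continuous_toLp 2 _ _).comp (by fun_prop))

theorem phasePoint_eq_zero_iff {x y ξ η : Rd d} :
    phasePoint x y ξ η = 0 ↔ (x = 0 ∧ y = 0) ∧ ξ = 0 ∧ η = 0 := by
  simp [phasePoint]

theorem norm_toLp_le (x y : Rd d) : ‖(WithLp.toLp 2 (x, y) : R2d d)‖ ≤ ‖x‖ + ‖y‖ := by
  refine abs_le_of_sq_le_sq' ?_ (by positivity) |>.2
  rw [WithLp.prod_norm_sq_eq_of_L2]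
  change ‖x‖ ^ 2 + ‖y‖ ^ 2 ≤ _
  nlinarith [mul_nonneg (norm_nonneg x) (norm_nonneg y)]

theorem one_add_norm_phasePoint_le (z w : Rd d × Rd d) :
    1 + ‖phasePoint z.1 w.1 z.2 w.2‖ ≤ (1 + ‖z‖) * (1 + ‖w‖) := by
  have h : ‖phasePoint z.1 w.1 z.2 w.2‖ ≤ ‖z‖ + ‖w‖ :=
    max_le ((norm_toLp_le _ _).trans (add_le_add (norm_fst_le z) (norm_fst_le w)))
      ((norm_toLp_le _ _).trans (add_le_add (norm_snd_le z) (norm_snd_le w)))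
  nlinarith [mul_nonneg (norm_nonneg z) (norm_nonneg w)]

theorem pairGrowth_kernelCoeff (K : 𝓢'(R2d d, ℂ)) (χ : 𝓢(Rd d, ℂ)) :
    PairGrowth (kernelCoeff K χ) := by
  obtain ⟨m, C, h⟩ := polyGrowth_apply_conjugate_atom K (tensor χ χ)
  refine ⟨m, |C|, fun z w ↦ ?_⟩
  rw [kernelCoeff, tensor_conjugate_atom, ← mul_pow]
  refine (h _).trans ?_
  have := one_add_norm_phasePoint_le z w
  gcongr
  exact le_abs_self C

/-- After a change to the tensor window, cone decay of `K` at a phase point of the product is decay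
of `kernelCoeff` on a product neighbourhood. -/
theorem exists_pairDecayOn_kernelCoeff {s : ℝ} (hs : 0 < s) {K : 𝓢'(R2d d, ℂ)}
    {Φ : 𝓢(R2d d, ℂ)} (hΦ : Φ ≠ 0) {χ : 𝓢(Rd d, ℂ)} (z w : Rd d × Rd d) (hzw : z ≠ 0 ∨ w ≠ 0)
    (h : phasePoint z.1 w.1 z.2 w.2 ∉ wavefront s Φ K) :
    ∃ U ∈ 𝓝 z, ∃ W ∈ 𝓝 w, PairDecayOn s (kernelCoeff K χ) U W := by
  rw [mem_wavefront_iff hs] at h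
  have hne : phasePoint z.1 w.1 z.2 w.2 ≠ 0 := by
    rw [Ne, phasePoint_eq_zero_iff]
    rintro ⟨⟨h1, h2⟩, h3, h4⟩
    exact hzw.elim (fun h ↦ h (Prod.ext h1 h3)) (fun h ↦ h (Prod.ext h2 h4))
  have hd : ConeDecay s (fun p ↦ K (conjugate (atom p Φ))) (phasePoint z.1 w.1 z.2 w.2) := by
    by_contra h'
    exact h ⟨hne, h'⟩
  obtain ⟨O, hO, hdec⟩ := hd.change_window hs hΦ (tensor χ χ)
  have hpre := continuous_phasePoint.continuousAt (x := (z, w)) hO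
  rw [mem_map, nhds_prod_eq, mem_prod_iff] at hpre
  obtain ⟨U, hU, W, hW, hUW⟩ := hpre
  refine ⟨U, hU, W, hW, fun N ↦ ?_⟩
  obtain ⟨C, hC⟩ := hdec N
  refine ⟨C, fun z' hz' w' hw' l hl ↦ ?_⟩
  rw [kernelCoeff, tensor_conjugate_atom]
  exact hC _ (hUW (Set.mk_mem_prod hz' hw')) l hl

theorem exists_pairDecayOn_sphere {s : ℝ} (hs : 0 < s) {K : 𝓢'(R2d d, ℂ)}
    {Φ : 𝓢(R2d d, ℂ)} (hΦ : Φ ≠ 0) (χ : 𝓢(Rd d, ℂ)) (hK₂ : secondAxis (wavefront s Φ K) = ∅) :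
    ∃ U ∈ 𝓝 (0 : Rd d × Rd d), PairDecayOn s (kernelCoeff K χ) U (Metric.sphere 0 1) := by
  refine exists_pairDecayOn_of_isCompact (isCompact_sphere _ _) fun w hw ↦ ?_
  have hw0 : w ≠ 0 := by rintro rfl; simp at hw
  refine exists_pairDecayOn_kernelCoeff hs hΦ 0 w (Or.inr hw0) fun hmem ↦ ?_
  have : (w.1, -w.2) ∈ secondAxis (wavefront s Φ K) := by
    simpa [secondAxis] using hmem
  rw [hK₂] at this
  exact this

/-- The distribution `f ↦ K (g ⊗ f)`. -/
def kernelLeft (K : 𝓢'(R2d d, ℂ)) (g : 𝓢(Rd d, ℂ)) : 𝓢'(Rd d, ℂ) :=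
  PointwiseConvergenceCLM.precomp ℂ (tensorRight g) K

theorem kernelLeft_apply (K : 𝓢'(R2d d, ℂ)) (g f : 𝓢(Rd d, ℂ)) :
    kernelLeft K g f = K (tensor g f) := rfl

theorem kernelLeft_conjugate_atom_eq_integral (K : 𝓢'(R2d d, ℂ)) {χ : 𝓢(Rd d, ℂ)} (hχ : χ ≠ 0)
    (g : 𝓢(Rd d, ℂ)) (w : Rd d × Rd d) : kernelLeft K g (conjugate (atom w χ)) =
      windowConst χ * ∫ z, windowCoeff χ g z * kernelCoeff K χ z w :=
  apply_eq_integral_windowCoeff hχ (kernelOp K (conjugate (atom w χ))) g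

/-- Inversion in the first variable writes the quantity as an integral over `z`. The growth `(1 +
‖z‖) ^ M` of the kernel bound is absorbed by the coefficients of `g`, with `D` further powers for
integrability. -/
theorem exists_seminorm_kernelLeft_le {s : ℝ} (hs : 0 < s) {K : 𝓢'(R2d d, ℂ)}
    {Φ : 𝓢(R2d d, ℂ)} (hΦ : Φ ≠ 0) {χ : 𝓢(Rd d, ℂ)} (hχ : χ ≠ 0)
    (hK₂ : secondAxis (wavefront s Φ K) = ∅) (N : ℕ) :
    ∃ q : Seminorm ℂ 𝓢(Rd d, ℂ), Continuous q ∧ ∀ g w,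
      (1 + ‖w‖) ^ N * ‖kernelLeft K g (conjugate (atom w χ))‖ ≤ q g := by
  obtain ⟨U, hU, hd⟩ := exists_pairDecayOn_sphere hs hΦ χ hK₂
  obtain ⟨M, C, hC⟩ := exists_decay_snd hs (pairGrowth_kernelCoeff K χ) hU hd N
  set D := Module.finrank ℝ (Rd d × Rd d) + 1
  obtain ⟨q, hq, hqle⟩ := exists_seminorm_windowCoeff_le χ (M + D)
  have hDint := integrable_inv_one_add_norm_pow (volume : Measure (Rd d × Rd d)) (D := D)
    (Nat.lt_succ_self _)
  set I := ∫ z : Rd d × Rd d, ((1 + ‖z‖) ^ D)⁻¹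
  have hI : 0 ≤ I := integral_nonneg fun z ↦ by positivity
  let c : NNReal := Real.toNNReal (‖windowConst χ‖ * (|C| * I))
  have hc : (c : ℝ) = ‖windowConst χ‖ * (|C| * I) := Real.coe_toNNReal _ (by positivity)
  refine ⟨c • q, (continuous_const.mul hq : Continuous fun f ↦ (c : ℝ) * q f), fun g w ↦ ?_⟩
  change _ ≤ (c : ℝ) * q g
  rw [hc, kernelLeft_conjugate_atom_eq_integral K hχ, norm_mul]
  have key : ∀ z, ‖(1 + ‖w‖) ^ N • (windowCoeff χ g z * kernelCoeff K χ z w)‖ ≤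
      (|C| * q g) * ((1 + ‖z‖) ^ D)⁻¹ := by
    intro z
    rw [← div_eq_mul_inv, le_div_iff₀ (by positivity), norm_smul, norm_mul,
      Real.norm_of_nonneg (by positivity)]
    calc _ = ((1 + ‖w‖) ^ N * ‖kernelCoeff K χ z w‖) * ‖windowCoeff χ g z‖ * (1 + ‖z‖) ^ D := by
          ring
      _ ≤ (|C| * (1 + ‖z‖) ^ M) * ‖windowCoeff χ g z‖ * (1 + ‖z‖) ^ D := by
          have h1 : (1 + ‖w‖) ^ N * ‖kernelCoeff K χ z w‖ ≤ |C| * (1 + ‖z‖) ^ M :=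
            (hC z w).trans (mul_le_mul_of_nonneg_right (le_abs_self C) (by positivity))
          exact mul_le_mul_of_nonneg_right (mul_le_mul_of_nonneg_right h1 (norm_nonneg _))
            (by positivity)
      _ = |C| * ((1 + ‖z‖) ^ (M + D) * ‖windowCoeff χ g z‖) := by rw [pow_add]; ring
      _ ≤ |C| * q g := by gcongr; exact hqle g z
  have hint : (1 + ‖w‖) ^ N * ‖∫ z, windowCoeff χ g z * kernelCoeff K χ z w‖ ≤
      (|C| * q g) * I := by
    have := norm_integral_le_of_norm_le (hDint.const_mul (|C| * q g)) (ae_of_all _ key)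
    rwa [integral_smul, norm_smul, Real.norm_of_nonneg (by positivity),
      integral_const_mul] at this
  calc _ = ‖windowConst χ‖ * ((1 + ‖w‖) ^ N *
        ‖∫ z, windowCoeff χ g z * kernelCoeff K χ z w‖) := by ring
    _ ≤ ‖windowConst χ‖ * ((|C| * q g) * I) := by gcongr
    _ = _ := by ring

theorem continuous_of_le_seminorm (f : 𝓢(Rd d, ℂ) →ₗ[ℂ] ℂ) (q : Seminorm ℂ 𝓢(Rd d, ℂ))
    (hq : Continuous q) (h : ∀ g, ‖f g‖ ≤ q g) : Continuous f := by
  obtain ⟨k, n, C, hC⟩ := exists_le_sup_seminorm q hq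
  exact WithSeminorms.continuous_normedSpace_rng _ (schwartz_withSeminorms ℂ _ ℂ) f
    ⟨Finset.Iic (k, n), C, fun g ↦ (h g).trans (hC g)⟩

/-- The extension of the kernel operator to tempered distributions, together with its integral
formula. -/
theorem exists_extension {s : ℝ} (hs : 0 < s) {K : 𝓢'(R2d d, ℂ)}
    {Φ : 𝓢(R2d d, ℂ)} (hΦ : Φ ≠ 0) {χ : 𝓢(Rd d, ℂ)} (hχ : χ ≠ 0)
    (hK₂ : secondAxis (wavefront s Φ K) = ∅) :
    ∃ T : 𝓢'(Rd d, ℂ) →ₗ[ℂ] 𝓢'(Rd d, ℂ), IsExtension K T ∧ ∀ u g,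
      T u g = windowConst χ * ∫ w, kernelLeft K g (conjugate (atom w χ)) * u (atom w χ) := by
  have hdec : ∀ g, RapidDecay fun w ↦ kernelLeft K g (conjugate (atom w χ)) := fun g N ↦
    let ⟨q, _, h⟩ := exists_seminorm_kernelLeft_le hs hΦ hχ hK₂ N
    ⟨q g, h g⟩
  have hmeas : ∀ g, AEStronglyMeasurable (fun w ↦ kernelLeft K g (conjugate (atom w χ))) :=
    fun g ↦ (continuous_apply_conjugate_atom (kernelLeft K g) χ).aestronglyMeasurable
  have hint : ∀ g (u : 𝓢'(Rd d, ℂ)),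
      Integrable fun w ↦ kernelLeft K g (conjugate (atom w χ)) * u (atom w χ) := fun g u ↦
    ((hdec g).mul_polyGrowth (polyGrowth_apply_atom u χ)).integrable volume
      ((hmeas g).mul (continuous_apply_atom u χ).aestronglyMeasurable)
  -- `G g` is the Schwartz superposition of atoms with these coefficients, so `T u g` is a multiple
  -- of `u (G g)`.
  choose G hG using fun g ↦ exists_synthesis (hmeas g) (hdec g) χ
  let ℓ : 𝓢'(Rd d, ℂ) → 𝓢(Rd d, ℂ) →ₗ[ℂ] ℂ := fun u ↦
    { toFun := fun g ↦ windowConst χ * u (G g)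
      map_add' := fun g₁ g₂ ↦ by
        have hadd : ∀ f, kernelLeft K (g₁ + g₂) f = kernelLeft K g₁ f + kernelLeft K g₂ f :=
          fun f ↦ map_add (kernelOp K f) g₁ g₂
        rw [hG, hG, hG, ← mul_add, ← integral_add (hint g₁ u) (hint g₂ u)]
        simp_rw [hadd, add_mul]
      map_smul' := fun c g ↦ by
        have hsmul : ∀ f, kernelLeft K (c • g) f = c * kernelLeft K g f :=
          fun f ↦ map_smul (kernelOp K f) c g
        rw [hG, hG, RingHom.id_apply, smul_eq_mul, mul_left_comm, ← integral_const_mul c]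
        simp_rw [hsmul, mul_assoc] }
  have hcont : ∀ u, Continuous (ℓ u) := by
    intro u
    obtain ⟨m, B, hB⟩ := polyGrowth_apply_atom u χ
    set D := Module.finrank ℝ (Rd d × Rd d) + 1
    -- The power `m` offsets the growth of `u (atom w χ)`; `D` makes the integral converge.
    obtain ⟨q, hq, hqle⟩ := exists_seminorm_kernelLeft_le hs hΦ hχ hK₂ (m + D)
    have hDint := integrable_inv_one_add_norm_pow (volume : Measure (Rd d × Rd d)) (D := D)
      (Nat.lt_succ_self _)
    set I := ∫ z : Rd d × Rd d, ((1 + ‖z‖) ^ D)⁻¹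
    have hI : 0 ≤ I := integral_nonneg fun z ↦ by positivity
    let c : NNReal := Real.toNNReal (‖windowConst χ‖ * (|B| * I))
    have hc : (c : ℝ) = ‖windowConst χ‖ * (|B| * I) := Real.coe_toNNReal _ (by positivity)
    refine continuous_of_le_seminorm (ℓ u) (c • q)
      (continuous_const.mul hq : Continuous fun f ↦ (c : ℝ) * q f) fun g ↦ ?_
    change ‖windowConst χ * u (G g)‖ ≤ (c : ℝ) * q g
    rw [hG, hc, norm_mul]
    have key : ∀ w, ‖kernelLeft K g (conjugate (atom w χ)) * u (atom w χ)‖ ≤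
        (|B| * q g) * ((1 + ‖w‖) ^ D)⁻¹ := by
      intro w
      rw [← div_eq_mul_inv, le_div_iff₀ (by positivity), norm_mul]
      calc _ ≤ ‖kernelLeft K g (conjugate (atom w χ))‖ * (|B| * (1 + ‖w‖) ^ m) *
              (1 + ‖w‖) ^ D := by
            gcongr
            refine (hB w).trans ?_
            gcongr
            exact le_abs_self B
        _ = |B| * ((1 + ‖w‖) ^ (m + D) * ‖kernelLeft K g (conjugate (atom w χ))‖) := by
            rw [pow_add]; ring
        _ ≤ |B| * q g := by gcongr; exact hqle g w
    have h1 := norm_integral_le_of_norm_le (hDint.const_mul (|B| * q g)) (ae_of_all _ key)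
    rw [integral_const_mul] at h1
    calc _ ≤ ‖windowConst χ‖ * ((|B| * q g) * I) := by gcongr
      _ = _ := by ring
  let T : 𝓢'(Rd d, ℂ) →ₗ[ℂ] 𝓢'(Rd d, ℂ) :=
    { toFun := fun u ↦ ContinuousLinearMap.toPointwiseConvergenceCLM _ _ _ _ ⟨ℓ u, hcont u⟩
      map_add' := fun u v ↦ by
        ext g
        exact mul_add (windowConst χ) (u (G g)) (v (G g))
      map_smul' := fun c u ↦ by
        ext g
        exact mul_left_comm (windowConst χ) c (u (G g)) }
  have hT : ∀ u g, T u g = windowConst χ * u (G g) := fun u g ↦ rfl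
  refine ⟨T, ⟨?_, fun f ↦ ?_⟩, fun u g ↦ by rw [hT, hG]⟩
  · have : Continuous T := PointwiseConvergenceCLM.continuous_of_continuous_eval fun g ↦
      continuous_const.mul (PointwiseConvergenceCLM.evalCLM (RingHom.id ℂ) ℂ (G g)).continuous
    exact this.seqContinuous
  · ext g
    rw [hT, hG]
    -- On a Schwartz function the formula for `T` is the inversion formula in the second variable.
    have h1 := apply_eq_integral_windowCoeff hχ (kernelLeft K g) f
    rw [kernelLeft_apply] at h1
    rw [kernelOp_apply, h1]
    congr 2
    ext w
    rw [toTemperedDistributionCLM_atom, mul_comm]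

theorem IsExtension.unique {K : 𝓢'(R2d d, ℂ)} {T T' : 𝓢'(Rd d, ℂ) →ₗ[ℂ] 𝓢'(Rd d, ℂ)}
    (hT : IsExtension K T) (hT' : IsExtension K T') : T = T' := by
  ext u g
  obtain ⟨f, hf⟩ := exists_seq_tendsto u
  have h1 := hT.seqContinuous hf
  have h2 := hT'.seqContinuous hf
  have e : T ∘ (fun n ↦ SchwartzMap.toTemperedDistributionCLM (Rd d) ℂ volume (f n)) =
      T' ∘ fun n ↦ SchwartzMap.toTemperedDistributionCLM (Rd d) ℂ volume (f n) := by
    ext1 n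
    exact (hT.extends_kernelOp (f n)).trans (hT'.extends_kernelOp (f n)).symm
  rw [e] at h1
  rw [PointwiseConvergenceCLM.tendsto_iff_forall_tendsto] at h1 h2
  exact tendsto_nhds_unique (h1 g) (h2 g)

/-- Decay of the kernel coefficients, weighted with the coefficients of `u`, near a point that
is not in the composition of the wave front sets. -/
theorem exists_decay_kernelCoeff_mul {s : ℝ} (hs : 0 < s) {K : 𝓢'(R2d d, ℂ)}
    {Φ : 𝓢(R2d d, ℂ)} (hΦ : Φ ≠ 0) {χ : 𝓢(Rd d, ℂ)} (hχ : χ ≠ 0)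
    (hK₁ : firstAxis (wavefront s Φ K) = ∅) (hK₂ : secondAxis (wavefront s Φ K) = ∅)
    {u : 𝓢'(Rd d, ℂ)} {φ : 𝓢(Rd d, ℂ)} (hφ : φ ≠ 0) {z₀ : Rd d × Rd d} (hz₀ : z₀ ≠ 0)
    (h : z₀ ∉ twistedComp (wavefront s Φ K) (wavefront s φ u)) :
    ∃ U ∈ 𝓝 z₀, ∀ N D : ℕ, ∃ C : ℝ, ∀ z ∈ U, ∀ l : ℝ, 1 ≤ l → ∀ W,
      l ^ N * (1 + ‖W‖) ^ D * ‖kernelCoeff K χ (dilation s l z) W * u (atom W χ)‖ ≤ C := by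
  obtain ⟨U₁, hU₁, hd₁⟩ := exists_pairDecayOn_sphere hs hΦ χ hK₂
  obtain ⟨R, -, hlarge⟩ := exists_decay_of_large_snd hs hU₁ hd₁ (‖z₀‖ + 1)
  obtain ⟨m, B, hB⟩ := polyGrowth_apply_atom u χ
  have hgrowth : PairGrowth fun _ w : Rd d × Rd d ↦ u (atom w χ) := by
    refine ⟨m, |B|, fun z w ↦ (hB w).trans ?_⟩
    have h1 : 1 ≤ (1 + ‖z‖) ^ m := one_le_pow₀ (le_add_of_nonneg_right (norm_nonneg z))
    refine mul_le_mul (le_abs_self B) ?_ (by positivity) (abs_nonneg B)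
    exact le_mul_of_one_le_left (by positivity) h1
  have hlocal : ∀ w ∈ Metric.closedBall (0 : Rd d × Rd d) R, ∃ U ∈ 𝓝 z₀, ∃ W ∈ 𝓝 w,
      PairDecayOn s (fun z w ↦ kernelCoeff K χ z w * u (atom w χ)) U W := by
    intro w _
    by_cases hmem : phasePoint z₀.1 w.1 z₀.2 w.2 ∈ wavefront s Φ K
    · have hw0 : w ≠ 0 := by
        rintro rfl
        have : z₀ ∈ firstAxis (wavefront s Φ K) := hmem
        rw [hK₁] at this
        exact this
      -- `u (atom w χ)` is the transform of `u` at `(w.1, -w.2)` for the window `conjugate χ`, up to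
      -- the normalizing constant.
      have hwu : (w.1, -w.2) ∉ wavefront s (conjugate χ) u := by
        rw [wavefront_eq hs (conjugate_ne_zero hχ) hφ]
        exact fun hw ↦ h ⟨_, hw, by simpa using hmem⟩
      rw [mem_wavefront_iff hs] at hwu
      have hne : (w.1, -w.2) ≠ (0 : Rd d × Rd d) := fun h0 ↦ hw0 (by
        rw [Prod.mk_eq_zero, neg_eq_zero] at h0
        exact Prod.ext h0.1 h0.2)
      obtain ⟨O, hO, hdec⟩ : ConeDecay s (fun z ↦ u (conjugate (atom z (conjugate χ))))
          (w.1, -w.2) := by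
        by_contra h'
        exact hwu ⟨hne, h'⟩
      have hpre := (by fun_prop : Continuous fun z : Rd d × Rd d ↦ (z.1, -z.2)).continuousAt
        (x := w) hO
      have hdU : PairDecayOn s (fun _ w : Rd d × Rd d ↦ u (atom w χ)) (Metric.ball z₀ 1)
          ((fun z : Rd d × Rd d ↦ (z.1, -z.2)) ⁻¹' O ∩ Metric.ball w 1) := by
        intro N
        obtain ⟨C, hC⟩ := hdec N
        refine ⟨C, fun z _ w' hw' l hl ↦ ?_⟩
        have := hC _ hw'.1 l hl
        simp only [conjugate_atom, conjugate_conjugate] at this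
        simpa [dilation] using this
      refine ⟨_, Metric.ball_mem_nhds z₀ one_pos, _,
        inter_mem hpre (Metric.ball_mem_nhds w one_pos), ?_⟩
      have := hdU.mul_pairGrowth (pairGrowth_kernelCoeff K χ) Metric.isBounded_ball
        (Metric.isBounded_ball.subset Set.inter_subset_right)
      simpa only [mul_comm] using this
    · obtain ⟨U, hU, W, hW, hd⟩ := exists_pairDecayOn_kernelCoeff hs hΦ (χ := χ) z₀ w
        (Or.inl hz₀) hmem
      refine ⟨_, inter_mem hU (Metric.ball_mem_nhds z₀ one_pos), _,
        inter_mem hW (Metric.ball_mem_nhds w one_pos), ?_⟩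
      exact (hd.mono Set.inter_subset_left Set.inter_subset_left).mul_pairGrowth hgrowth
        (Metric.isBounded_ball.subset Set.inter_subset_right)
        (Metric.isBounded_ball.subset Set.inter_subset_right)
  obtain ⟨U₂, hU₂, hd₂⟩ := exists_pairDecayOn_of_isCompact (isCompact_closedBall _ _) hlocal
  obtain ⟨a, ha⟩ := exists_norm_dilation_le (V := Rd d) s
  refine ⟨U₂ ∩ Metric.ball z₀ 1, inter_mem hU₂ (Metric.ball_mem_nhds z₀ one_pos),
    fun N D ↦ ?_⟩
  -- For large `w` the extra `m` covers the growth of `u`; for bounded `w` the weight `(1 + ‖W‖) ^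
  -- D` costs at most a multiple of `l ^ (a * D)`.
  obtain ⟨C₁, hC₁⟩ := hlarge N (D + m)
  obtain ⟨C₂, hC₂⟩ := hd₂ (N + a * D)
  refine ⟨max (|B| * |C₁|) ((1 + R) ^ D * |C₂|), fun z hz l hl W ↦ ?_⟩
  have hl0 : 0 < l := zero_lt_one.trans_le hl
  have hW := dilation_dilation_inv (s := s) hl0 W
  set w := dilation s l⁻¹ W
  rcases le_total ‖w‖ R with hwR | hwR
  · refine le_trans ?_ (le_max_right _ _)
    have h1 := hC₂ z hz.1 w (by simpa using hwR) l hl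
    have h2 := one_add_norm_dilation_le hl ha hwR
    rw [hW] at h1 h2
    have hR0 : 0 ≤ R := (norm_nonneg w).trans hwR
    calc _ ≤ l ^ N * (l ^ a * (1 + R)) ^ D *
          ‖kernelCoeff K χ (dilation s l z) W * u (atom W χ)‖ := by gcongr
      _ = (1 + R) ^ D * (l ^ (N + a * D) *
          ‖kernelCoeff K χ (dilation s l z) W * u (atom W χ)‖) := by
        rw [mul_pow, ← pow_mul, pow_add]; ring
      _ ≤ _ := by gcongr; exact h1.trans (le_abs_self C₂)
  · refine le_trans ?_ (le_max_left _ _)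
    have hzn : ‖z‖ ≤ ‖z₀‖ + 1 := by
      have h3 : ‖z - z₀‖ < 1 := by simpa [dist_eq_norm] using hz.2
      have h4 : ‖z‖ ≤ ‖z - z₀‖ + ‖z₀‖ := by simpa using norm_add_le (z - z₀) z₀
      linarith
    have h1 := hC₁ z w hzn hwR l hl
    rw [hW] at h1
    calc _ ≤ l ^ N * (1 + ‖W‖) ^ D * (‖kernelCoeff K χ (dilation s l z) W‖ *
          (|B| * (1 + ‖W‖) ^ m)) := by
          rw [norm_mul]
          gcongr
          refine (hB W).trans ?_
          gcongr
          exact le_abs_self B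
      _ = |B| * (l ^ N * (1 + ‖W‖) ^ (D + m) * ‖kernelCoeff K χ (dilation s l z) W‖) := by
          rw [pow_add]; ring
      _ ≤ _ := by gcongr; exact h1.trans (le_abs_self C₁)

theorem wavefront_subset_twistedComp {s : ℝ} (hs : 0 < s) {K : 𝓢'(R2d d, ℂ)}
    {Φ : 𝓢(R2d d, ℂ)} (hΦ : Φ ≠ 0) {χ : 𝓢(Rd d, ℂ)} (hχ : χ ≠ 0)
    (hK₁ : firstAxis (wavefront s Φ K) = ∅) (hK₂ : secondAxis (wavefront s Φ K) = ∅)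
    {u v : 𝓢'(Rd d, ℂ)} {φ : 𝓢(Rd d, ℂ)} (hφ : φ ≠ 0)
    (hv : ∀ g, v g =
      windowConst χ * ∫ w, kernelLeft K g (conjugate (atom w χ)) * u (atom w χ)) :
    wavefront s χ v ⊆ twistedComp (wavefront s Φ K) (wavefront s φ u) := by
  intro z₀ hz₀
  rw [mem_wavefront_iff hs] at hz₀
  by_contra hcomp
  obtain ⟨U, hU, hdec⟩ := exists_decay_kernelCoeff_mul hs hΦ hχ hK₁ hK₂ hφ hz₀.1 hcomp
  refine hz₀.2 ⟨U, hU, fun N ↦ ?_⟩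
  set D := Module.finrank ℝ (Rd d × Rd d) + 1
  obtain ⟨C, hC⟩ := hdec N D
  have hDint := integrable_inv_one_add_norm_pow (volume : Measure (Rd d × Rd d)) (D := D)
    (Nat.lt_succ_self _)
  refine ⟨‖windowConst χ‖ * (C * ∫ w : Rd d × Rd d, ((1 + ‖w‖) ^ D)⁻¹), fun z hz l hl ↦ ?_⟩
  have hl0 : 0 ≤ l := zero_le_one.trans hl
  change l ^ N * ‖v (conjugate (atom (dilation s l z) χ))‖ ≤ _
  rw [hv, norm_mul, mul_left_comm]
  refine mul_le_mul_of_nonneg_left ?_ (norm_nonneg _)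
  have key : ∀ w, ‖l ^ N • (kernelLeft K (conjugate (atom (dilation s l z) χ))
      (conjugate (atom w χ)) * u (atom w χ))‖ ≤ C * ((1 + ‖w‖) ^ D)⁻¹ := by
    intro w
    rw [← div_eq_mul_inv, le_div_iff₀ (by positivity), norm_smul,
      Real.norm_of_nonneg (by positivity), mul_right_comm]
    exact hC z hz l hl w
  have := norm_integral_le_of_norm_le (hDint.const_mul C) (ae_of_all _ key)
  rwa [integral_smul, norm_smul, Real.norm_of_nonneg (by positivity),
    integral_const_mul] at this

end Kernel

end

end GaborWF

/-- The wave front sets of `K`, `u` and `𝒦 u` are computed with arbitrary nonzero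
windows `Φ`, `φ` and `ψ`. -/
theorem theorem4p4 (d : ℕ) (s : ℝ) (hs : 0 < s) (K : 𝓢'(GaborWF.R2d d, ℂ))
    (Φ : 𝓢(GaborWF.R2d d, ℂ)) (hΦ : Φ ≠ 0)
    (hK₁ : GaborWF.firstAxis (GaborWF.wavefront s Φ K) = ∅)
    (hK₂ : GaborWF.secondAxis (GaborWF.wavefront s Φ K) = ∅) :
    (∃! T : 𝓢'(GaborWF.Rd d, ℂ) →ₗ[ℂ] 𝓢'(GaborWF.Rd d, ℂ), GaborWF.IsExtension K T) ∧
    ∀ T : 𝓢'(GaborWF.Rd d, ℂ) →ₗ[ℂ] 𝓢'(GaborWF.Rd d, ℂ), GaborWF.IsExtension K T →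
      ∀ φ ψ : 𝓢(GaborWF.Rd d, ℂ), φ ≠ 0 → ψ ≠ 0 → ∀ u : 𝓢'(GaborWF.Rd d, ℂ),
        GaborWF.wavefront s ψ (T u) ⊆
          GaborWF.twistedComp (GaborWF.wavefront s Φ K) (GaborWF.wavefront s φ u) := by
  obtain ⟨χ, hχ⟩ := GaborWF.exists_ne_zero (V := GaborWF.Rd d)
  obtain ⟨T₀, hT₀, hformula⟩ := GaborWF.exists_extension hs hΦ hχ hK₂
  refine ⟨⟨T₀, hT₀, fun T hT ↦ hT.unique hT₀⟩, fun T hT φ ψ hφ hψ u ↦ ?_⟩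
  -- The integral formula is known only for `T₀` and for the window `χ`.
  rw [hT.unique hT₀, GaborWF.wavefront_eq hs hψ hχ]
  exact GaborWF.wavefront_subset_twistedComp hs hΦ hχ hK₁ hK₂ hφ (hformula u)
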